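/- **Definitions.** An *involutory set* $(K,K_0,\sigma)$ consists of a skew-field $K$, an involution $\sigma$ of $K$ (an anti-automorphism with $\sigma^2=\mathrm{id}$) and an additive subgroup $K_0\subseteq K$ with $1\in K_0$, $\{a+a^\sigma\mid a\in K\}\subseteq K_0\subseteq \mathrm{Fix}(\sigma)$ and $a^\sigma K_0a\subseteq K_0$ for all $a\in K$. It is *proper* if $\sigma\neq\mathrm{id}$ and $K_0$ generates $K$ as a ring. It is *quadratic of type (iii)* if $K$ is commutative, $K_0$ is a subfield, $K/K_0$ is a separable quadratic extension and $\langle\sigma\rangle=\mathrm{Gal}(K/K_0)$; it is *quadratic of type (iv)* if $K$ is a quaternion division algebra over its center, $K_0=Z(K)$ and $\sigma$ is the standard involution. A *pseudo-quadratic space* $\Xi=(K,K_0,\sigma,L_0,q)$ consists of an involutory set $(K,K_0,\sigma)$, a right $K$-vector space $L_0$ and a map $q:L_0\to K$ for which there is a skew-hermitian form $f$ on $L_0$ (biadditive, $f(as,bt)=s^\sigma f(a,b)t$, $f(a,b)^\sigma=-f(b,a)$) with $q(a+b)\equiv q(a)+q(b)+f(a,b)$ and $q(at)\equiv t^\sigma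 q(a)t \pmod{K_0}$, and with $q(a)\in K_0\Leftrightarrow a=0$. It is *proper* if $\sigma\ne\mathrm{id}$, $L_0\neq 0$ and $f$ (which is then unique) is non-degenerate. Its group is $T=\{(a,t)\in L_0\times K\mid q(a)-t\in K_0\}$ with $(a,t)(b,v)=(a+b,\,t+v+f(b,a))$. An *isomorphism* $\Phi=(\varphi,\phi):\Xi\to\tilde\Xi$ consists of a group isomorphism $\varphi:L_0\to\tilde L_0$ and an isomorphism of skew-fields $\phi:K\to\tilde K$ with $\varphi(at)=\varphi(a)\phi(t)$, $\phi(K_0)=\tilde K_0$, $\phi\circ\sigma=\tilde\sigma\circ\phi$ and $\phi(q(a))\equiv\tilde q(\varphi(a))\pmod{\tilde K_0}$. It *induces* $\gamma:T\to\tilde T$ if $\gamma(a,t)=(\varphi(a),\phi(t))$ for all $(a,t)\in T$. For proper $\Xi,\tilde\Xi$, a *Jordan isomorphism* $\gamma:T\to\tilde T$ is a group isomorphism with $\gamma(0,1)=(0,1)$ and $\gamma(h_{(a,t)}(b,v))=\tilde h_{\gamma(a,t)}(\gamma(b,v))$ for all $(a,t),(b,v)\in T$, where $h_{(a,t)}(b,v)=(bt^\sigma-at^{-1}f(a,b)t^\sigma,\;tvt^\sigma)$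 (and $h_{(0,0)}(b,v)=(0,0)$). **Theorem.** Let $\Xi=(K,K_0,\sigma,L_0,q)$ and $\tilde\Xi=(\tilde K,\tilde K_0,\tilde\sigma,\tilde L_0,\tilde q)$ be proper pseudo-quadratic spaces, let $\gamma:T\to\tilde T$ be a Jordan isomorphism, and suppose that one of the following holds: (i) $(K,K_0,\sigma)$ is proper; (ii) $(K,K_0,\sigma)$ is quadratic of type (iii) or (iv) and $\dim_KL_0\ge3$; (iii) $(K,K_0,\sigma)$ is quadratic of type (iii) or (iv), $\dim_KL_0\le2$, $K\not\cong\mathbb F_4$, and there is an isomorphism of skew-fields $\psi:K\to\tilde K$, where, if $(K,K_0,\sigma)$ is of type (iv) and $\dim_KL_0=2$, the isomorphism $\psi$ is required to be compatible with the identification of the centers given by $\gamma$, i.e. $\gamma(0,t)=(0,\psi(t))$ for all $t\in K_0=Z(K)$. Then $\gamma$ is induced by an isomorphism $\Phi:\Xi\to\tilde\Xi$ of pseudo-quadratic spaces. -/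

import Mathlib

open MulOpposite

/-- An involutory set `(K, K₀, σ)`: `K` is a skew-field, the involution `σ` is the `star` of `K`,
and `K₀` is an additive subgroup with `1 ∈ K₀`, `{a + a^σ} ⊆ K₀ ⊆ Fix σ` and `a^σ K₀ a ⊆ K₀`. -/
structure InvolutorySet (K : Type*) [DivisionRing K] [StarRing K] where
  K₀ : AddSubgroup K
  one_mem : (1 : K) ∈ K₀
  add_star_mem : ∀ a : K, a + star a ∈ K₀
  star_eq : ∀ t ∈ K₀, star t = t
  conj_mem : ∀ a : K, ∀ t ∈ K₀, star a * t * a ∈ K₀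

namespace InvolutorySet

variable {K : Type*} [DivisionRing K] [StarRing K]

/-- `σ ≠ id` and `K₀` generates `K` as a ring. -/
def IsProperInvolutorySet (S : InvolutorySet K) : Prop :=
  (∃ x : K, star x ≠ x) ∧ Subring.closure (S.K₀ : Set K) = ⊤

/-- Quadratic of type (iii): `K` is commutative, `K₀` is (the underlying set of) a subfield `F` of
`K`, `K / F` is a separable quadratic extension, and `σ` generates `Gal(K / F)`. -/
def IsQuadraticOfTypeIII (S : InvolutorySet K) : Prop :=
  ∃ hcomm : ∀ x y : K, x * y = y * x,
    letI : Field K := { ‹DivisionRing K› with mul_comm := hcomm }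
    ∃ F : Subfield K, (F : Set K) = (S.K₀ : Set K) ∧
      Algebra.IsSeparable F K ∧ Module.finrank F K = 2 ∧
      ∃ s : K ≃ₐ[F] K, (∀ x, s x = star x) ∧ Subgroup.zpowers s = ⊤

/-- Quadratic of type (iv): `K` is a quaternion (division) algebra over its center `Z`, `K₀ = Z`,
and `σ` is the standard involution. Mathlib's `QuaternionAlgebra Z a b c` is
`Z[i] ⊕ Z[i] j` with `i² = a + b i`, `j² = c`, `j i = (b - i) j`, and its `star` is the standard
involution; `b² + 4 a ≠ 0` says that `X² - b X - a` is separable. -/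
def IsQuadraticOfTypeIV (S : InvolutorySet K) : Prop :=
  (S.K₀ : Set K) = Set.center K ∧
    ∃ a b c : Subring.center K, b ^ 2 + 4 * a ≠ 0 ∧
      ∃ e : QuaternionAlgebra (Subring.center K) a b c ≃ₐ[Subring.center K] K,
        ∀ x, e (star x) = star (e x)

end InvolutorySet

/-- An (anisotropic, right) pseudo-quadratic space `(K, K₀, σ, L, q)` with associated
skew-hermitian form `f`. The right scalar multiplication `a · t` is `op t • a`. By `form_unique`
below, `f` is determined by `q` as soon as `σ ≠ id`. -/
structure PseudoQuadraticSpace (K L : Type*) [DivisionRing K] [StarRing K] [AddCommGroup L]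
    [Module Kᵐᵒᵖ L] extends InvolutorySet K where
  q : L → K
  f : L → L → K
  f_add_left : ∀ a b c, f (a + b) c = f a c + f b c
  f_add_right : ∀ a b c, f a (b + c) = f a b + f a c
  f_smul_smul : ∀ a b (s t : K), f (op s • a) (op t • b) = star s * f a b * t
  star_f : ∀ a b, star (f a b) = - f b a
  q_add : ∀ a b, q (a + b) - (q a + q b + f a b) ∈ K₀
  q_smul : ∀ a (t : K), q (op t • a) - star t * q a * t ∈ K₀
  q_mem_iff : ∀ a, q a ∈ K₀ ↔ a = 0

namespace PseudoQuadraticSpace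

variable {K L : Type*} [DivisionRing K] [StarRing K] [AddCommGroup L] [Module Kᵐᵒᵖ L]

/-- `σ ≠ id`, `L ≠ 0` and the associated skew-hermitian form is non-degenerate. -/
structure IsProper (X : PseudoQuadraticSpace K L) : Prop where
  star_ne : ∃ x : K, star x ≠ x
  nontrivial : Nontrivial L
  nondegenerate : ∀ a, (∀ b, X.f a b = 0) → a = 0

variable (X : PseudoQuadraticSpace K L)

theorem f_smul_left (a b : L) (s : K) : X.f (op s • a) b = star s * X.f a b := by
  simpa using X.f_smul_smul a b s 1

theorem f_smul_right (a b : L) (t : K) : X.f a (op t • b) = X.f a b * t := by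
  simpa using X.f_smul_smul a b 1 t

theorem f_zero_left (a : L) : X.f 0 a = 0 := by
  simpa using X.f_add_left 0 0 a

theorem f_zero_right (a : L) : X.f a 0 = 0 := by
  simpa using X.f_add_right a 0 0

theorem f_neg_left (a b : L) : X.f (-a) b = -X.f a b := by
  have h := X.f_add_left (-a) a b
  rw [neg_add_cancel, f_zero_left] at h
  exact eq_neg_of_add_eq_zero_left h.symm

theorem f_neg_right (a b : L) : X.f a (-b) = -X.f a b := by
  have h := X.f_add_right a (-b) b
  rw [neg_add_cancel, f_zero_right] at h
  exact eq_neg_of_add_eq_zero_left h.symm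

theorem q_zero_mem : X.q 0 ∈ X.K₀ := (X.q_mem_iff 0).2 rfl

/-- If `K₀ ≠ K`, then `K₀` contains no nonzero right ideal of `K`. -/
theorem eq_zero_of_forall_mem {x : K} (h : ∀ t, x * t ∈ X.K₀) (hK : ∃ y, y ∉ X.K₀) : x = 0 := by
  by_contra hx
  obtain ⟨y, hy⟩ := hK
  exact hy (by simpa [mul_inv_cancel_left₀ hx] using h (x⁻¹ * y))

/-- The skew-hermitian form of a pseudo-quadratic space with `σ ≠ id` is determined by `q`. -/
theorem form_unique (Y : PseudoQuadraticSpace K L) (hS : X.K₀ = Y.K₀) (hq : X.q = Y.q)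
    (hσ : ∃ x : K, star x ≠ x) : X.f = Y.f := by
  funext a b
  obtain ⟨y, hy⟩ := hσ
  refine sub_eq_zero.1 (X.eq_zero_of_forall_mem (fun t => ?_) ⟨y, fun h => hy (X.star_eq y h)⟩)
  have h1 := X.q_add a (op t • b)
  have h2 := Y.q_add a (op t • b)
  rw [← hS, ← hq] at h2
  have h3 := X.K₀.sub_mem h2 h1
  rw [f_smul_right] at h3
  rw [f_smul_right] at h3
  convert h3 using 1
  noncomm_ring

/-- `f(a, a) = q(a) - q(a)^σ`. -/
theorem f_self (a : L) : X.f a a = X.q a - star (X.q a) := by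
  by_cases hK : ∃ y, y ∉ X.K₀
  · have key : X.f a a - X.q a + star (X.q a) = 0 := by
      refine X.eq_zero_of_forall_mem (fun t => ?_) hK
      have h1 := X.q_add a (op t • a)
      have h2 := X.q_smul a (1 + t)
      have h3 := X.q_smul a t
      have h4 := X.add_star_mem (star t * X.q a)
      have e : op (1 + t) • a = a + op t • a := by simp [add_smul]
      rw [e] at h2
      rw [f_smul_right] at h1
      have h5 := X.K₀.sub_mem (X.K₀.add_mem (X.K₀.sub_mem h2 h1) h4) h3
      convert h5 using 1
      simp only [star_add, star_one, star_mul, star_star]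
      noncomm_ring
    have : X.f a a = X.f a a - X.q a + star (X.q a) + (X.q a - star (X.q a)) := by abel
    rw [this, key, zero_add]
  · push Not at hK
    have ha : a = 0 := (X.q_mem_iff a).1 (hK _)
    subst ha
    rw [X.star_eq _ (hK _), f_zero_left, sub_self]

/-- The set `T = {(a, t) ∈ L × K | q(a) - t ∈ K₀}`. -/
@[ext]
structure T where
  vec : L
  scal : K
  mem : X.q vec - scal ∈ X.K₀

variable {X}

/-- `f(a, a) = t - t^σ` for `(a, t) ∈ T`. -/
theorem T.f_self (x : X.T) : X.f x.vec x.vec = x.scal - star x.scal := by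
  have h := X.star_eq _ x.mem
  rw [star_sub] at h
  rw [X.f_self]
  have e : X.q x.vec - star (X.q x.vec) - (x.scal - star x.scal) = 0 := by
    have : X.q x.vec - star (X.q x.vec) - (x.scal - star x.scal) =
      (X.q x.vec - x.scal) - (star (X.q x.vec) - star x.scal) := by abel
    rw [this, h, sub_self]
  exact sub_eq_zero.1 e

theorem T.mul_mem (x y : X.T) :
    X.q (x.vec + y.vec) - (x.scal + y.scal + X.f y.vec x.vec) ∈ X.K₀ := by
  have h1 := X.q_add x.vec y.vec
  have h2 := X.add_star_mem (X.f x.vec y.vec)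
  rw [X.star_f] at h2
  have h3 := X.K₀.add_mem (X.K₀.add_mem (X.K₀.add_mem h1 h2) x.mem) y.mem
  convert h3 using 1
  abel

theorem T.inv_mem (x : X.T) : X.q (-x.vec) - -star x.scal ∈ X.K₀ := by
  have h1 := X.q_add x.vec (-x.vec)
  rw [add_neg_cancel, X.f_neg_right, x.f_self] at h1
  have h2 := X.K₀.sub_mem (X.K₀.sub_mem X.q_zero_mem h1) x.mem
  convert h2 using 1
  abel

/-- `(a, t) · (b, v) = (a + b, t + v + f(b, a))`. -/
instance : Mul X.T := ⟨fun x y => ⟨x.vec + y.vec, x.scal + y.scal + X.f y.vec x.vec, x.mul_mem y⟩⟩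

instance : One X.T := ⟨⟨0, 0, by simpa using X.q_zero_mem⟩⟩

/-- `(a, t)⁻¹ = (-a, -t^σ)`. -/
instance : Inv X.T := ⟨fun x => ⟨-x.vec, -star x.scal, x.inv_mem⟩⟩

instance : Group X.T :=
  Group.ofLeftAxioms
    (fun x y z => T.ext (add_assoc _ _ _) (by
      change x.scal + y.scal + X.f y.vec x.vec + z.scal + X.f z.vec (x.vec + y.vec) =
        x.scal + (y.scal + z.scal + X.f z.vec y.vec) + X.f (y.vec + z.vec) x.vec
      rw [X.f_add_left, X.f_add_right]
      abel))
    (fun x => T.ext (zero_add _) (by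
      change 0 + x.scal + X.f x.vec 0 = x.scal
      rw [X.f_zero_right, zero_add, add_zero]))
    (fun x => T.ext (neg_add_cancel _) (by
      change -star x.scal + x.scal + X.f x.vec (-x.vec) = 0
      rw [X.f_neg_right, x.f_self]
      abel))

/-- The element `(0, t)` of `T`, for `t ∈ K₀`. -/
def T.ofK₀ (t : X.K₀) : X.T := ⟨0, t, X.K₀.sub_mem X.q_zero_mem t.2⟩

theorem T.scal_ne_zero (x : X.T) (h : x.vec ≠ 0) : x.scal ≠ 0 := fun h0 =>
  h ((X.q_mem_iff _).1 (by simpa [h0] using x.mem))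

theorem T.hua_mem (x y : X.T) :
    X.q (op (star x.scal) • y.vec -
        op (x.scal⁻¹ * X.f x.vec y.vec * star x.scal) • x.vec) -
      x.scal * y.scal * star x.scal ∈ X.K₀ := by
  obtain ⟨a, t, hat⟩ := x
  obtain ⟨b, v, hbv⟩ := y
  dsimp only
  by_cases ht : t = 0
  · subst ht
    simpa using X.q_zero_mem
  have hσ : star t ≠ 0 := by simpa using ht
  set s := t⁻¹ * X.f a b * star t with hs
  have h1 := X.q_add (op (star t) • b) (-(op s • a))
  rw [← sub_eq_add_neg] at h1
  have h2 := X.q_smul b (star t)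
  have h3 := X.q_smul a (-s)
  have e : op (-s) • a = -(op s • a) := by simp
  rw [e] at h3
  have h4 := X.conj_mem (star t) _ hbv
  have h5 := X.conj_mem s _ hat
  have h6 := X.conj_mem (X.f a b * star t) _ (X.add_star_mem t⁻¹)
  rw [X.f_neg_right, X.f_smul_smul] at h1
  have h7 := X.K₀.add_mem (X.K₀.add_mem (X.K₀.add_mem (X.K₀.add_mem (X.K₀.add_mem h1 h2) h3) h4)
    h5) h6
  convert h7 using 1
  have e1 : star (star t) * X.f b a * s =
      -(star (X.f a b * star t) * t⁻¹ * (X.f a b * star t)) := by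
    rw [star_mul, X.star_f, hs]
    noncomm_ring
  have e2 : star s * t * s =
      star (X.f a b * star t) * star t⁻¹ * (X.f a b * star t) := by
    rw [hs, mul_assoc t⁻¹, star_mul _ (_ * _)]
    simp only [mul_assoc, mul_inv_cancel_left₀ ht]
  rw [e1, mul_sub (star s), sub_mul _ _ s, e2, star_neg, star_star]
  noncomm_ring

/-- The Hua map `h_{(a,t)} : (b, v) ↦ (b t^σ - a t⁻¹ f(a, b) t^σ, t v t^σ)`
(for `(a, t) = (0, 0)` it is constantly `(0, 0)`). -/
def T.hua (x y : X.T) : X.T :=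
  ⟨op (star x.scal) • y.vec - op (x.scal⁻¹ * X.f x.vec y.vec * star x.scal) • x.vec,
    x.scal * y.scal * star x.scal, x.hua_mem y⟩

variable {K' L' : Type*} [DivisionRing K'] [StarRing K'] [AddCommGroup L'] [Module K'ᵐᵒᵖ L']
  {X' : PseudoQuadraticSpace K' L'}

/-- A Jordan isomorphism: an isomorphism of groups `T → T'` that maps `(0, 1)` to `(0, 1)` and,
written `γ(a, t) = (φ₁(a), φ₂(a, t))`, satisfies
`φ₁(b t^σ - a t⁻¹ f(a, b) t^σ) = φ₁(b) φ₂(a, t)^σ - φ₁(a) φ₂(a, t)⁻¹ f(φ₁(a), φ₁(b)) φ₂(a, t)^σ`,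
`φ₂(b t^σ - a t⁻¹ f(a, b) t^σ, t v t^σ) = φ₂(a, t) φ₂(b, v) φ₂(a, t)^σ`
for all `(a, t), (b, v) ∈ T`; these are the two components of `map_hua`. -/
structure IsJordanIso (γ : X.T ≃* X'.T) : Prop where
  map_unit : γ (T.ofK₀ ⟨1, X.one_mem⟩) = T.ofK₀ ⟨1, X'.one_mem⟩
  map_hua : ∀ x y : X.T, γ (x.hua y) = (γ x).hua (γ y)

/-- An isomorphism `(φ, ϕ) : (L, K) → (L', K')` of pseudo-quadratic spaces. -/
structure Iso (X : PseudoQuadraticSpace K L) (X' : PseudoQuadraticSpace K' L') where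
  vec : L ≃+ L'
  scal : K ≃+* K'
  map_smul : ∀ (a : L) (t : K), vec (op t • a) = op (scal t) • vec a
  map_star : ∀ t, scal (star t) = star (scal t)
  map_K₀ : scal '' (X.K₀ : Set K) = (X'.K₀ : Set K')
  map_q : ∀ a, scal (X.q a) - X'.q (vec a) ∈ X'.K₀

/-- `γ` is induced by `Φ = (φ, ϕ)`: `γ(a, t) = (φ(a), ϕ(t))` for all `(a, t) ∈ T`. -/
def Iso.Induces (Φ : Iso X X') (γ : X.T ≃* X'.T) : Prop :=
  ∀ x : X.T, (γ x).vec = Φ.vec x.vec ∧ (γ x).scal = Φ.scal x.scal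

end PseudoQuadraticSpace

/-! ### Involutory sets: either `K₀` generates `K`, or `K₀` is a central subfield. -/

namespace InvolutorySet

variable {K : Type*} [DivisionRing K] [StarRing K] (S : InvolutorySet K)

/-! The center of `T` is `{0} × K₀`, so `γ` induces additive maps `vecMap : L → L'`, written `a ↦
a'` below, and `scalMap : K₀ → K₀'`. The Hua maps of `(0, k)` give `(b k)' = b' scalMap k`. The
elements of `K` whose right multiplication is carried to a right multiplication (`multipliers`) thus
form a subring containing `K₀`. Once this subring is `K`, there is a ring homomorphism `ϕ`, and it
remains to match involutions and scalars.

If `K₀` generates `K`, this is immediate, and two non-commuting elements of `K₀` force the rest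
(`exists_iso_of_isProperInvolutorySet`). Otherwise a Cartan-Brauer-Hua argument makes `K₀` central,
and likewise `K₀'`.

In the central case let `(a, t) ∈ T` have image `(a', s)`. Polarizing the Hua identity in `t ↦ t +
k` gives `(a t)' = a' s` and `(b t)' + (a f(a,b))' = b' s + a' f'(a',b')`. This needs a third
element of `K₀`; without one `K` is the field of four elements, which is excluded by hypothesis or,
in dimension at least 3, by anisotropy. To get `(b t)' = b' s` for all `b`, split `b` along `a^⊥`,
`a (K₀ + K₀ t)` and `a j` with `t j = j t^σ`. Only the last kind can go wrong: `(a j)'` might be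
orthogonal to `a'` instead of lying in `a' K'`.

For `γ⁻¹` such a failure is an `IsObstruction`: some `c` orthogonal to `a` with `c' = a' j'`. Then
`f(c,c) ≠ 0` and no nonzero vector is orthogonal to both `a` and `c`, which rules out dimension at
least 3 and dimension 1. In dimension 2 over a quaternion algebra, `ψ` yields `i₀ ∈ K` such that `a
i₀ + c` is a nonzero vector with `q(a i₀ + c) ∈ K₀`. Over commutative fields no nonzero skew `j'`
exists. -/

theorem mul_mul_star_mem (a : K) {t : K} (ht : t ∈ S.K₀) : a * t * star a ∈ S.K₀ := by
  simpa using S.conj_mem (star a) t ht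

theorem mul_star_mem (a : K) : a * star a ∈ S.K₀ := by
  simpa using S.mul_mul_star_mem a S.one_mem

theorem star_mul_mem (a : K) : star a * a ∈ S.K₀ := by
  simpa using S.mul_star_mem (star a)

theorem inv_mem {k : K} (hk : k ∈ S.K₀) : k⁻¹ ∈ S.K₀ := by
  by_cases h0 : k = 0
  · simp [h0]
  · have h := S.mul_mul_star_mem k⁻¹ hk
    rwa [star_inv₀, S.star_eq k hk, inv_mul_cancel₀ h0, one_mul] at h

/-- `K₀` is contained in the center of `K`. -/
def IsCentral : Prop := ∀ k ∈ S.K₀, ∀ x : K, k * x = x * k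

theorem star_mem_closure {x : K} (hx : x ∈ Subring.closure (S.K₀ : Set K)) :
    star x ∈ Subring.closure (S.K₀ : Set K) := by
  induction hx using Subring.closure_induction with
  | mem x hx => rw [S.star_eq x hx]; exact Subring.subset_closure hx
  | zero => simp
  | one => simp
  | add x y _ _ hx hy => rw [star_add]; exact add_mem hx hy
  | neg x _ hx => rw [star_neg]; exact neg_mem hx
  | mul x y _ _ hx hy => rw [star_mul]; exact mul_mem hy hx

theorem inv_mem_closure {x : K} (hx : x ∈ Subring.closure (S.K₀ : Set K)) :
    x⁻¹ ∈ Subring.closure (S.K₀ : Set K) := by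
  by_cases h0 : x = 0
  · simp [h0]
  have h1 : star x ≠ 0 := by simpa using h0
  have h : x⁻¹ = star x * (x * star x)⁻¹ := by
    rw [mul_inv_rev, mul_inv_cancel_left₀ h1]
  rw [h]
  exact mul_mem (S.star_mem_closure hx)
    (Subring.subset_closure (S.inv_mem (S.mul_star_mem x)))

/-- On generators, `a k a⁻¹ = (a k a^σ) · ((a⁻¹)^σ a⁻¹)` is a product of two elements of `K₀`. -/
theorem conj_mem_closure {a x : K} (ha : a ≠ 0) (hx : x ∈ Subring.closure (S.K₀ : Set K)) :
    a * x * a⁻¹ ∈ Subring.closure (S.K₀ : Set K) := by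
  have hs : star a ≠ 0 := by simpa using ha
  induction hx using Subring.closure_induction with
  | mem x hx =>
    have h : a * x * a⁻¹ = a * x * star a * (star a⁻¹ * a⁻¹) := by
      rw [star_inv₀, mul_assoc (a * x), mul_inv_cancel_left₀ hs]
    rw [h]
    exact mul_mem (Subring.subset_closure (S.mul_mul_star_mem a hx))
      (Subring.subset_closure (S.star_mul_mem a⁻¹))
  | zero => simp
  | one => simp [ha]
  | add x y _ _ hx hy => rw [mul_add, add_mul]; exact add_mem hx hy
  | neg x _ hx => rw [mul_neg, neg_mul]; exact neg_mem hx
  | mul x y _ _ hx hy =>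
    have h : a * (x * y) * a⁻¹ = a * x * a⁻¹ * (a * y * a⁻¹) := by
      simp only [mul_assoc, inv_mul_cancel_left₀ ha]
    rw [h]
    exact mul_mem hx hy

/-- If `K₀` does not generate `K`, then `K₀` is central (by the Cartan-Brauer-Hua argument). -/
theorem isCentral_of_closure_ne_top (h : Subring.closure (S.K₀ : Set K) ≠ ⊤) : S.IsCentral := by
  set R := Subring.closure (S.K₀ : Set K) with hR
  obtain ⟨z, hz⟩ : ∃ z, z ∉ R := by
    by_contra hc
    push Not at hc
    exact h (eq_top_iff.2 fun x _ => hc x)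
  -- Conjugation by `x` and by `1 + x` both preserve `R`. Comparing the two gives `r - r2 = (r2 -
  -- r1) x`, so `x ∉ R` forces `r1 = r2 = r`.
  have key : ∀ x, x ∉ R → ∀ r ∈ R, r * x = x * r := by
    intro x hx r hr
    have hx0 : x ≠ 0 := fun h0 => hx (h0 ▸ zero_mem R)
    have hx1 : 1 + x ≠ 0 := fun h0 => hx (by
      rw [eq_neg_of_add_eq_zero_right h0]; exact neg_mem R.one_mem)
    obtain ⟨r1, e1, h1⟩ : ∃ r1, x * r = r1 * x ∧ r1 ∈ R :=
      ⟨x * r * x⁻¹, by rw [inv_mul_cancel_right₀ hx0], S.conj_mem_closure hx0 hr⟩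
    obtain ⟨r2, e2, h2⟩ : ∃ r2, (1 + x) * r = r2 * (1 + x) ∧ r2 ∈ R :=
      ⟨(1 + x) * r * (1 + x)⁻¹, by rw [inv_mul_cancel_right₀ hx1], S.conj_mem_closure hx1 hr⟩
    have e3 : r - r2 = (r2 - r1) * x := by
      rw [add_mul, one_mul, mul_add, mul_one, e1] at e2
      rw [sub_mul, sub_eq_sub_iff_add_eq_add, e2, add_comm]
    by_cases h12 : r2 - r1 = 0
    · rw [h12, zero_mul, sub_eq_zero] at e3
      rw [e1, e3, sub_eq_zero.1 h12]
    · refine absurd ?_ hx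
      have : x = (r2 - r1)⁻¹ * (r - r2) := by rw [e3, inv_mul_cancel_left₀ h12]
      rw [this]
      exact mul_mem (S.inv_mem_closure (sub_mem h2 h1)) (sub_mem hr h2)
  intro k hk x
  have hkR : k ∈ R := Subring.subset_closure hk
  by_cases hx : x ∈ R
  · have hzx : z + x ∉ R := fun hc => hz (by simpa using sub_mem hc hx)
    have h1 := key _ hzx k hkR
    rw [mul_add, add_mul, key z hz k hkR] at h1
    exact add_left_cancel h1
  · exact key x hx k hkR

variable {S}

namespace IsCentral

theorem mul_star_comm (hZ : S.IsCentral) (x : K) : x * star x = star x * x := by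
  by_cases h0 : x = 0
  · simp [h0]
  · have h := hZ _ (S.mul_star_mem x) x
    rw [mul_assoc] at h
    exact (mul_left_cancel₀ h0 h).symm

/-- If `m = x + x^σ ≠ 0`, then `k l` is the trace of `k l m⁻¹ x`. Such an `x` exists, since
vanishing traces give characteristic 2 and then `σ = id`. -/
theorem mul_mem (hZ : S.IsCentral) (hσ : ∃ x : K, star x ≠ x) {k l : K} (hk : k ∈ S.K₀)
    (hl : l ∈ S.K₀) : k * l ∈ S.K₀ := by
  obtain ⟨x, hx⟩ : ∃ x : K, x + star x ≠ 0 := by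
    by_contra hc
    push Not at hc
    have h1 := hc 1
    obtain ⟨x, hx⟩ := hσ
    apply hx
    have h2 : x + x = 0 := by
      rw [star_one] at h1
      rw [← mul_one x, ← mul_add, h1, mul_zero]
    have h3 := hc x
    rw [← h2] at h3
    exact add_left_cancel h3
  have hm := S.add_star_mem x
  set m := x + star x with hm'
  have hi := S.inv_mem hm
  have h := S.add_star_mem (k * (l * (m⁻¹ * x)))
  have e : k * (l * (m⁻¹ * x)) + star (k * (l * (m⁻¹ * x))) = k * l := by
    rw [star_mul, star_mul, star_mul, S.star_eq k hk, S.star_eq l hl, S.star_eq _ hi,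
      ← hZ _ hi, ← hZ l hl, ← hZ k hk, ← mul_add, ← mul_add, ← mul_add, ← hm',
      inv_mul_cancel₀ hx, mul_one]
  rwa [e] at h

theorem star_commute (hZ : S.IsCentral) {t w : K} (h : w * t = t * w) :
    w * star t = star t * w := by
  have h1 := hZ _ (S.add_star_mem t) w
  rw [add_mul, mul_add, h] at h1
  exact (add_left_cancel h1).symm

/-- Elements `j` with `t j = j t^σ` also satisfy `j t = t^σ j`. -/
theorem skew_mul (hZ : S.IsCentral) {t j : K} (h : t * j = j * star t) :
    j * t = star t * j := by
  have h1 := hZ _ (S.add_star_mem t) j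
  rw [add_mul, mul_add, h, add_comm] at h1
  exact (add_right_cancel h1).symm

theorem star_of_skew (hZ : S.IsCentral) {t j : K} (ht : star t ≠ t) (h : t * j = j * star t) :
    star j = -j := by
  have h1 : t * star j = star j * star t := by
    have := congrArg star h
    simpa using this.symm
  have h2 := hZ _ (S.add_star_mem j) t
  have h3 : t * (j + star j) = (j + star j) * star t := by rw [mul_add, h, h1, add_mul]
  rw [← h2] at h3
  have h4 : (j + star j) * (t - star t) = 0 := by rw [mul_sub, h3, sub_self]
  rcases mul_eq_zero.1 h4 with h5 | h5
  · exact eq_neg_of_add_eq_zero_right h5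
  · exact absurd (sub_eq_zero.1 h5).symm ht

/-- `K` is spanned by the centralizer of `t` and the elements `w` with `t w = w t^σ`. -/
theorem exists_add_skew (hZ : S.IsCentral) {t : K} (ht : star t ≠ t) (x : K) :
    ∃ e w, x = e + w ∧ e * t = t * e ∧ t * w = w * star t := by
  have hd : t - star t ≠ 0 := fun h => ht (sub_eq_zero.1 h).symm
  have hv : t * (t * x - x * t) = (t * x - x * t) * star t := by
    have h1 := hZ _ (S.add_star_mem t) x
    have h2 := hZ _ (S.mul_star_mem t) x
    have e1 : t * (t * x - x * t) = t * ((t + star t) * x) - t * star t * x - t * x * t := by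
      noncomm_ring
    have e2 : (t * x - x * t) * star t =
      t * (x * (t + star t)) - x * (t * star t) - t * x * t := by noncomm_ring
    rw [e1, e2, h1, h2]
  have hdt : (t - star t) * t = t * (t - star t) := by
    rw [sub_mul, mul_sub, hZ.mul_star_comm]
  have hdi : (t - star t)⁻¹ * t = t * (t - star t)⁻¹ := by
    have : Commute (t - star t) t := hdt
    exact this.inv_left₀
  -- The commutator with `t` kills the commuting part and multiplies the skew part by `t - t^σ`, so
  -- dividing recovers the skew part.
  set w := (t - star t)⁻¹ * (t * x - x * t) with hw
  have hwt : t * w = w * star t := by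
    rw [hw, ← mul_assoc, ← hdi, mul_assoc, hv, mul_assoc]
  refine ⟨x - w, w, by abel, ?_, hwt⟩
  have h1 : t * w - w * t = t * x - x * t := by
    rw [hZ.skew_mul hwt, ← sub_mul, hw, mul_inv_cancel_left₀ hd]
  rw [sub_mul, mul_sub]
  rw [sub_eq_sub_iff_add_eq_add, add_comm, ← sub_eq_sub_iff_add_eq_add]
  rw [h1]

/-- `K₀ + K₀ t` is closed under multiplication. -/
theorem lin_mul (hZ : S.IsCentral) (hσ : ∃ x : K, star x ≠ x) {t x y : K}
    (hx : ∃ k ∈ S.K₀, ∃ l ∈ S.K₀, x = k + l * t) (hy : ∃ k ∈ S.K₀, ∃ l ∈ S.K₀, y = k + l * t) :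
    ∃ k ∈ S.K₀, ∃ l ∈ S.K₀, x * y = k + l * t := by
  obtain ⟨k, hk, l, hl, rfl⟩ := hx
  obtain ⟨k', hk', l', hl', rfl⟩ := hy
  have hT := S.add_star_mem t
  have hN := S.star_mul_mem t
  have hll := hZ.mul_mem hσ hl hl'
  refine ⟨k * k' - l * l' * (star t * t),
    sub_mem (hZ.mul_mem hσ hk hk') (hZ.mul_mem hσ hll hN),
    k * l' + l * k' + l * l' * (t + star t),
    add_mem (add_mem (hZ.mul_mem hσ hk hl') (hZ.mul_mem hσ hl hk')) (hZ.mul_mem hσ hll hT), ?_⟩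
  have e1 : (k + l * t) * (k' + l' * t) =
      k * k' + k * l' * t + l * (t * k') + l * (t * l') * t := by
    noncomm_ring
  rw [e1, ← hZ k' hk' t, ← hZ l' hl' t]
  noncomm_ring

/-- The centralizer of an element `t` with `t^σ ≠ t` is `K₀ + K₀ t`. -/
theorem exists_lin_of_commute (hZ : S.IsCentral) (hσ : ∃ x : K, star x ≠ x) {t w : K}
    (ht : star t ≠ t) (hw : w * t = t * w) : ∃ k ∈ S.K₀, ∃ l ∈ S.K₀, w = k + l * t := by
  have hd : t - star t ≠ 0 := fun h => ht (sub_eq_zero.1 h).symm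
  have hm := S.add_star_mem (w * t)
  have hT := S.add_star_mem t
  have hTw := S.add_star_mem w
  have hδ : (t - star t) * (t - star t) ∈ S.K₀ := by
    have := S.K₀.neg_mem (S.mul_star_mem (t - star t))
    rwa [star_sub, star_star, ← mul_neg, neg_sub] at this
  -- The right side is `Tr(w t) - t^σ Tr(w)`, which lies in `K₀ + K₀ t`. Division by `t - t^σ` stays
  -- there because its square is in `K₀`; no division by 2 occurs.
  have h1 : w * (t - star t) = w * t + star (w * t) - star t * (w + star w) := by
    rw [star_mul, mul_sub, hZ.star_commute hw]
    noncomm_ring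
  have h2 : w = (w * t + star (w * t) - star t * (w + star w)) * (t - star t) *
      ((t - star t) * (t - star t))⁻¹ := by
    rw [← h1, mul_assoc w, mul_inv_cancel_right₀ (mul_ne_zero hd hd)]
  have c0 : ∀ {k : K}, k ∈ S.K₀ → ∃ k₁ ∈ S.K₀, ∃ l ∈ S.K₀, k = k₁ + l * t := fun {k} hk =>
    ⟨k, hk, 0, S.K₀.zero_mem, by simp⟩
  have cs : ∃ k₁ ∈ S.K₀, ∃ l ∈ S.K₀, star t = k₁ + l * t :=
    ⟨_, hT, -1, S.K₀.neg_mem S.one_mem, by noncomm_ring⟩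
  have cd : ∃ k₁ ∈ S.K₀, ∃ l ∈ S.K₀, t - star t = k₁ + l * t :=
    ⟨_, S.K₀.neg_mem hT, 1 + 1, S.K₀.add_mem S.one_mem S.one_mem, by noncomm_ring⟩
  obtain ⟨k, hk, l, hl, e⟩ := hZ.lin_mul hσ cs (c0 hTw)
  have cm : ∃ k₁ ∈ S.K₀, ∃ l ∈ S.K₀,
      w * t + star (w * t) - star t * (w + star w) = k₁ + l * t :=
    ⟨_, sub_mem hm hk, _, S.K₀.neg_mem hl, by rw [e]; noncomm_ring⟩
  rw [h2]
  exact hZ.lin_mul hσ (hZ.lin_mul hσ cm cd) (c0 (S.inv_mem hδ))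

end IsCentral

end InvolutorySet

/-! ### Maps on `L` and `K₀` induced by a Jordan isomorphism. -/

namespace PseudoQuadraticSpace

open scoped RightActions

variable {K L K' L' : Type*}
  [DivisionRing K] [StarRing K] [AddCommGroup L] [Module Kᵐᵒᵖ L]
  [DivisionRing K'] [StarRing K'] [AddCommGroup L'] [Module K'ᵐᵒᵖ L']
  {X' : PseudoQuadraticSpace K' L'} {X : PseudoQuadraticSpace K L}

theorem T.mul_vec (x y : X.T) : (x * y).vec = x.vec + y.vec := rfl

theorem T.mul_scal (x y : X.T) : (x * y).scal = x.scal + y.scal + X.f y.vec x.vec := rfl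

theorem T.ofK₀_vec (k : X.K₀) : (T.ofK₀ k : X.T).vec = 0 := rfl

theorem T.ofK₀_scal (k : X.K₀) : (T.ofK₀ k : X.T).scal = k := rfl

theorem T.mul_ofK₀_vec (x : X.T) (k : X.K₀) : (x * T.ofK₀ k).vec = x.vec := by
  rw [T.mul_vec, T.ofK₀_vec, add_zero]

theorem T.mul_ofK₀_scal (x : X.T) (k : X.K₀) : (x * T.ofK₀ k).scal = x.scal + k := by
  rw [T.mul_scal, T.ofK₀_vec, X.f_zero_left, T.ofK₀_scal, add_zero]

theorem T.eq_ofK₀ (x : X.T) (h : x.vec = 0) : ∃ hk : x.scal ∈ X.K₀, x = T.ofK₀ ⟨x.scal, hk⟩ := by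
  have hm := x.mem
  rw [h] at hm
  have hk : x.scal ∈ X.K₀ := by simpa using sub_mem X.q_zero_mem hm
  exact ⟨hk, T.ext h rfl⟩

theorem T.exists_mul_ofK₀ (x y : X.T) (h : x.vec = y.vec) :
    ∃ k : X.K₀, x = y * T.ofK₀ k := by
  have hm := x.mem
  rw [h] at hm
  have hk : x.scal - y.scal ∈ X.K₀ := by simpa using sub_mem y.mem hm
  exact ⟨⟨_, hk⟩, T.ext (by rw [T.mul_ofK₀_vec, h]) (by
    rw [T.mul_ofK₀_scal, add_sub_cancel])⟩

/-- The element `(a, q(a))` of `T`. -/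
def T.ofVec (X : PseudoQuadraticSpace K L) (a : L) : X.T :=
  ⟨a, X.q a, by simp [X.K₀.zero_mem]⟩

theorem f_surjective (hX : X.IsProper) {a : L} (ha : a ≠ 0) (u : K) : ∃ b, X.f a b = u := by
  obtain ⟨b, hb⟩ : ∃ b, X.f a b ≠ 0 := by
    by_contra hc
    push Not at hc
    exact ha (hX.nondegenerate a hc)
  exact ⟨b <• ((X.f a b)⁻¹ * u), by rw [X.f_smul_right, mul_inv_cancel_left₀ hb]⟩

/-- Since `f(a, ·)` is onto for `a ≠ 0`, a central `(a, t)` would give `u = -u^σ` for all `u`. Then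
`u = 1` yields characteristic 2, hence `σ = id`. -/
theorem mem_center_iff (hX : X.IsProper) (x : X.T) :
    x ∈ Subgroup.center X.T ↔ x.vec = 0 := by
  rw [Subgroup.mem_center_iff]
  constructor
  · intro h
    by_contra ha
    have key : ∀ u : K, u = -star u := by
      intro u
      obtain ⟨b, rfl⟩ := f_surjective hX ha u
      have h1 := congrArg T.scal (h (T.ofVec X b))
      rw [T.mul_scal, T.mul_scal, add_comm (T.ofVec X b).scal] at h1
      rw [X.star_f, neg_neg]
      exact add_left_cancel h1
    obtain ⟨y, hy⟩ := hX.star_ne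
    have h1 := key 1
    rw [star_one] at h1
    apply hy
    have h2 := key y
    rw [← neg_one_mul, ← h1, one_mul] at h2
    exact h2.symm
  · intro h g
    refine T.ext ?_ ?_
    · rw [T.mul_vec, T.mul_vec, add_comm]
    · rw [T.mul_scal, T.mul_scal, h, X.f_zero_left, X.f_zero_right, add_comm g.scal]

theorem right_smul_cancel {K L : Type*} [DivisionRing K] [AddCommGroup L] [Module Kᵐᵒᵖ L] {a : L}
    (ha : a ≠ 0) {s t : K} (h : a <• s = a <• t) : s = t :=
  op_injective (smul_left_injective _ ha h)

theorem norm_add_one {R : Type*} [Ring R] [StarRing R] (t : R) :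
    (t + 1) * star (t + 1) = t * star t + (t + star t) + 1 := by
  rw [star_add, star_one]
  noncomm_ring

/-- The map `L → L'` induced by `γ` on the first components. -/
def vecMap (γ : X.T ≃* X'.T) (a : L) : L' := (γ (T.ofVec X a)).vec

open Classical in
/-- The map `K₀ → K₀'` induced by `γ` on the centers, extended by `0`. -/
noncomputable def scalMap (γ : X.T ≃* X'.T) (k : K) : K' :=
  if h : k ∈ X.K₀ then (γ (T.ofK₀ ⟨k, h⟩)).scal else 0

/-- A Jordan isomorphism between proper pseudo-quadratic spaces. -/
structure IsProperJordanIso (γ : X.T ≃* X'.T) : Prop where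
  proper : X.IsProper
  proper' : X'.IsProper
  jordan : IsJordanIso γ

namespace IsProperJordanIso

variable {γ : X.T ≃* X'.T}

theorem symm (h : IsProperJordanIso γ) : IsProperJordanIso γ.symm where
  proper := h.proper'
  proper' := h.proper
  jordan :=
    { map_unit := by rw [MulEquiv.symm_apply_eq, h.jordan.map_unit]
      map_hua := fun x y => by
        rw [MulEquiv.symm_apply_eq, h.jordan.map_hua, MulEquiv.apply_symm_apply,
          MulEquiv.apply_symm_apply] }

theorem vec_ofK₀ (h : IsProperJordanIso γ) (k : X.K₀) : (γ (T.ofK₀ k)).vec = 0 := by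
  rw [← mem_center_iff h.proper', Subgroup.mem_center_iff]
  intro g
  have h1 := (mem_center_iff h.proper (T.ofK₀ k)).2 rfl
  rw [Subgroup.mem_center_iff] at h1
  obtain ⟨g, rfl⟩ := γ.surjective g
  rw [← map_mul, h1, map_mul]

theorem map_ofK₀ (h : IsProperJordanIso γ) {k : K} (hk : k ∈ X.K₀) :
    ∃ hk' : scalMap γ k ∈ X'.K₀, γ (T.ofK₀ ⟨k, hk⟩) = T.ofK₀ ⟨scalMap γ k, hk'⟩ := by
  obtain ⟨hk', e⟩ := T.eq_ofK₀ _ (h.vec_ofK₀ ⟨k, hk⟩)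
  have : scalMap γ k = (γ (T.ofK₀ ⟨k, hk⟩)).scal := by rw [scalMap, dif_pos hk]
  refine ⟨this ▸ hk', T.ext (h.vec_ofK₀ _) this.symm⟩

theorem scalMap_mem (h : IsProperJordanIso γ) {k : K} (hk : k ∈ X.K₀) : scalMap γ k ∈ X'.K₀ :=
  (h.map_ofK₀ hk).1

theorem map_vec (h : IsProperJordanIso γ) (x : X.T) : (γ x).vec = vecMap γ x.vec := by
  obtain ⟨k, hk⟩ := T.exists_mul_ofK₀ x (T.ofVec X x.vec) rfl
  conv_lhs => rw [hk]
  rw [map_mul, T.mul_vec, h.vec_ofK₀, add_zero, vecMap]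

theorem vecMap_add (h : IsProperJordanIso γ) (a b : L) :
    vecMap γ (a + b) = vecMap γ a + vecMap γ b := by
  have h1 := h.map_vec (T.ofVec X a * T.ofVec X b)
  rw [map_mul, T.mul_vec] at h1
  exact h1.symm

theorem vecMap_zero (h : IsProperJordanIso γ) : vecMap γ (0 : L) = 0 := by
  simpa using h.vecMap_add 0 0

theorem vecMap_neg (h : IsProperJordanIso γ) (a : L) : vecMap γ (-a) = -vecMap γ a := by
  rw [eq_neg_iff_add_eq_zero, ← h.vecMap_add, neg_add_cancel, h.vecMap_zero]

theorem vecMap_sub (h : IsProperJordanIso γ) (a b : L) :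
    vecMap γ (a - b) = vecMap γ a - vecMap γ b := by
  rw [sub_eq_add_neg, h.vecMap_add, h.vecMap_neg, sub_eq_add_neg]

theorem symm_vecMap (h : IsProperJordanIso γ) (a : L) : vecMap γ.symm (vecMap γ a) = a := by
  have h1 := h.symm.map_vec (γ (T.ofVec X a))
  rw [MulEquiv.symm_apply_apply] at h1
  exact h1.symm

theorem vecMap_symm (h : IsProperJordanIso γ) (a : L') : vecMap γ (vecMap γ.symm a) = a :=
  h.symm.symm_vecMap a

theorem vecMap_injective (h : IsProperJordanIso γ) : Function.Injective (vecMap γ) :=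
  Function.LeftInverse.injective h.symm_vecMap

theorem vecMap_eq_zero (h : IsProperJordanIso γ) {a : L} : vecMap γ a = 0 ↔ a = 0 := by
  rw [← h.vecMap_zero, h.vecMap_injective.eq_iff]

theorem symm_scalMap (h : IsProperJordanIso γ) {k : K} (hk : k ∈ X.K₀) :
    scalMap γ.symm (scalMap γ k) = k := by
  obtain ⟨hk', e⟩ := h.map_ofK₀ hk
  obtain ⟨hk'', e'⟩ := h.symm.map_ofK₀ hk'
  rw [← e, MulEquiv.symm_apply_apply] at e'
  exact (congrArg T.scal e').symm

theorem scalMap_symm (h : IsProperJordanIso γ) {k : K'} (hk : k ∈ X'.K₀) :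
    scalMap γ (scalMap γ.symm k) = k :=
  h.symm.symm_scalMap hk

theorem map_mul_ofK₀_scal (h : IsProperJordanIso γ) (x : X.T) (k : X.K₀) :
    (γ (x * T.ofK₀ k)).scal = (γ x).scal + scalMap γ k := by
  obtain ⟨hk', e⟩ := h.map_ofK₀ k.2
  rw [map_mul, e, T.mul_ofK₀_scal]

theorem scalMap_add (h : IsProperJordanIso γ) {k l : K} (hk : k ∈ X.K₀) (hl : l ∈ X.K₀) :
    scalMap γ (k + l) = scalMap γ k + scalMap γ l := by
  obtain ⟨_, e⟩ := h.map_ofK₀ hk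
  obtain ⟨_, e'⟩ := h.map_ofK₀ (add_mem hk hl)
  have h1 := h.map_mul_ofK₀_scal (T.ofK₀ ⟨k, hk⟩) ⟨l, hl⟩
  have h2 : T.ofK₀ ⟨k, hk⟩ * T.ofK₀ ⟨l, hl⟩ = (T.ofK₀ ⟨k + l, add_mem hk hl⟩ : X.T) :=
    T.ext (by rw [T.mul_ofK₀_vec]; rfl) (by rw [T.mul_ofK₀_scal]; rfl)
  rw [h2, e, e'] at h1
  exact h1

theorem scalMap_zero (h : IsProperJordanIso γ) : scalMap γ 0 = 0 := by
  simpa using h.scalMap_add X.K₀.zero_mem X.K₀.zero_mem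

theorem scalMap_neg (h : IsProperJordanIso γ) {k : K} (hk : k ∈ X.K₀) :
    scalMap γ (-k) = -scalMap γ k := by
  rw [eq_neg_iff_add_eq_zero, ← h.scalMap_add (neg_mem hk) hk, neg_add_cancel, h.scalMap_zero]

theorem scalMap_one (h : IsProperJordanIso γ) : scalMap γ 1 = 1 := by
  rw [scalMap, dif_pos X.one_mem, h.jordan.map_unit, T.ofK₀_scal]

theorem scalMap_eq_zero (h : IsProperJordanIso γ) {k : K} (hk : k ∈ X.K₀) :
    scalMap γ k = 0 ↔ k = 0 := by
  constructor
  · intro h0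
    rw [← h.symm_scalMap hk, h0, h.symm.scalMap_zero]
  · rintro rfl
    exact h.scalMap_zero

theorem vecMap_smul (h : IsProperJordanIso γ) (b : L) {k : K} (hk : k ∈ X.K₀) :
    vecMap γ (b <• k) = vecMap γ b <• scalMap γ k := by
  obtain ⟨hk', e⟩ := h.map_ofK₀ hk
  have h1 := congrArg T.vec (h.jordan.map_hua (T.ofK₀ ⟨k, hk⟩) (T.ofVec X b))
  rw [h.map_vec, e] at h1
  simp only [T.hua, T.ofK₀, smul_zero, sub_zero, X.star_eq k hk, X'.star_eq _ hk'] at h1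
  exact h1

theorem vecMap_hua (h : IsProperJordanIso γ) (x : X.T) (b : L) :
    vecMap γ (b <• star x.scal - x.vec <• (x.scal⁻¹ * X.f x.vec b * star x.scal)) =
      vecMap γ b <• star (γ x).scal - vecMap γ x.vec <•
        ((γ x).scal⁻¹ * X'.f (vecMap γ x.vec) (vecMap γ b) * star (γ x).scal) := by
  have h1 := congrArg T.vec (h.jordan.map_hua x (T.ofVec X b))
  rw [h.map_vec] at h1
  simp only [T.hua, h.map_vec] at h1
  exact h1

theorem scalMap_conj (h : IsProperJordanIso γ) (x : X.T) {v : K} (hv : v ∈ X.K₀) :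
    scalMap γ (x.scal * v * star x.scal) = (γ x).scal * scalMap γ v * star (γ x).scal := by
  obtain ⟨hv', e⟩ := h.map_ofK₀ hv
  obtain ⟨_, e'⟩ := h.map_ofK₀ (X.mul_mul_star_mem x.scal hv)
  have h1 := congrArg T.scal (h.jordan.map_hua x (T.ofK₀ ⟨v, hv⟩))
  have h2 : x.hua (T.ofK₀ ⟨v, hv⟩) =
      T.ofK₀ ⟨x.scal * v * star x.scal, X.mul_mul_star_mem x.scal hv⟩ :=
    T.ext (by simp [T.hua, T.ofK₀, X.f_zero_right]) rfl
  rw [h2, e', e] at h1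
  exact h1

theorem scalMap_norm (h : IsProperJordanIso γ) (x : X.T) :
    scalMap γ (x.scal * star x.scal) = (γ x).scal * star (γ x).scal := by
  simpa [h.scalMap_one] using h.scalMap_conj x X.one_mem

/-- The trace is the linear part of the norm: apply `scalMap_norm` to `(a, t + 1)` as well and
subtract. -/
theorem scalMap_trace (h : IsProperJordanIso γ) (x : X.T) :
    scalMap γ (x.scal + star x.scal) = (γ x).scal + star (γ x).scal := by
  have h1 := h.scalMap_norm (x * T.ofK₀ ⟨1, X.one_mem⟩)
  rw [T.mul_ofK₀_scal, h.map_mul_ofK₀_scal, h.scalMap_one] at h1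
  rw [norm_add_one, norm_add_one,
    h.scalMap_add (add_mem (X.mul_star_mem _) (X.add_star_mem _)) X.one_mem,
    h.scalMap_add (X.mul_star_mem _) (X.add_star_mem _), h.scalMap_one, h.scalMap_norm] at h1
  exact add_left_cancel (add_right_cancel h1)

/-- The trace of `f(a, b)` is a commutator in `T`, hence is visible to the group structure. -/
theorem scalMap_trace_f (h : IsProperJordanIso γ) (a b : L) :
    scalMap γ (X.f a b + star (X.f a b)) =
      X'.f (vecMap γ a) (vecMap γ b) + star (X'.f (vecMap γ a) (vecMap γ b)) := by
  have h1 : T.ofVec X b * T.ofVec X a = T.ofVec X a * T.ofVec X b *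
      T.ofK₀ ⟨X.f a b + star (X.f a b), X.add_star_mem _⟩ := by
    refine T.ext ?_ ?_
    · rw [T.mul_ofK₀_vec, T.mul_vec, T.mul_vec, add_comm]
    · rw [T.mul_ofK₀_scal, T.mul_scal, T.mul_scal]
      change X.q b + X.q a + X.f a b = X.q a + X.q b + X.f b a + (X.f a b + star (X.f a b))
      rw [X.star_f]
      abel
  have h2 := congrArg (fun z => (γ z).scal) h1
  rw [h.map_mul_ofK₀_scal, map_mul, map_mul, T.mul_scal, T.mul_scal, h.map_vec, h.map_vec] at h2
  simp only [T.ofVec] at h2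
  rw [X'.star_f]
  rw [add_comm (γ _).scal, add_assoc, add_assoc, add_assoc] at h2
  have h3 := add_left_cancel (add_left_cancel h2)
  rw [h3]
  abel

/-- The elements of `K` whose right multiplication on `L` corresponds under `γ` to a right
multiplication on `L'`. -/
def multipliers (h : IsProperJordanIso γ) : Subring K where
  carrier := {x | ∃ y : K', ∀ a, vecMap γ (a <• x) = vecMap γ a <• y}
  mul_mem' := by
    rintro x y ⟨u, hu⟩ ⟨v, hv⟩
    exact ⟨u * v, fun a => by rw [op_mul, op_mul, mul_smul, mul_smul, hv, hu]⟩
  one_mem' := ⟨1, fun a => by simp⟩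
  add_mem' := by
    rintro x y ⟨u, hu⟩ ⟨v, hv⟩
    exact ⟨u + v, fun a => by rw [op_add, op_add, add_smul, add_smul, h.vecMap_add, hu, hv]⟩
  zero_mem' := ⟨0, fun a => by simp [h.vecMap_zero]⟩
  neg_mem' := by
    rintro x ⟨u, hu⟩
    exact ⟨-u, fun a => by rw [op_neg, op_neg, neg_smul, neg_smul, h.vecMap_neg, hu]⟩

theorem mem_multipliers (h : IsProperJordanIso γ) {k : K} (hk : k ∈ X.K₀) : k ∈ h.multipliers :=
  ⟨_, fun a => h.vecMap_smul a hk⟩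

/-- A ring homomorphism compatible with `γ` exists as soon as right multiplications correspond to
right multiplications under `γ`. -/
theorem exists_ringHom (h : IsProperJordanIso γ)
    (hP : ∀ x : K, ∃ y : K', ∀ a, vecMap γ (a <• x) = vecMap γ a <• y) :
    ∃ ϕ : K →+* K', ∀ a x, vecMap γ (a <• x) = vecMap γ a <• ϕ x := by
  obtain ⟨a₀, ha₀⟩ := @exists_ne L' h.proper'.nontrivial 0
  choose ϕ hϕ using hP
  have inj : ∀ y z : K', (∀ a, vecMap γ a <• y = vecMap γ a <• z) → y = z := by
    intro y z hyz
    have := hyz (vecMap γ.symm a₀)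
    rw [h.vecMap_symm] at this
    exact right_smul_cancel ha₀ this
  refine ⟨⟨⟨⟨ϕ, ?_⟩, ?_⟩, ?_, ?_⟩, fun a x => hϕ x a⟩
  · refine inj _ _ fun a => ?_
    rw [← hϕ, op_one, op_one, one_smul, one_smul]
  · intro x y
    refine inj _ _ fun a => ?_
    rw [← hϕ, op_mul, op_mul, mul_smul, mul_smul, hϕ, hϕ]
  · refine inj _ _ fun a => ?_
    change vecMap γ a <• ϕ 0 = _
    rw [← hϕ, op_zero, op_zero, zero_smul, zero_smul, h.vecMap_zero]
  · intro x y
    refine inj _ _ fun a => ?_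
    change vecMap γ a <• ϕ (x + y) = vecMap γ a <• (ϕ x + ϕ y)
    rw [← hϕ, op_add, op_add, add_smul, add_smul, h.vecMap_add, hϕ, hϕ]

theorem eq_scalMap (h : IsProperJordanIso γ) {ϕ : K → K'}
    (hϕ : ∀ a x, vecMap γ (a <• x) = vecMap γ a <• ϕ x) {k : K} (hk : k ∈ X.K₀) :
    ϕ k = scalMap γ k := by
  obtain ⟨a₀, ha₀⟩ := @exists_ne L h.proper.nontrivial 0
  have h1 := hϕ a₀ k
  rw [h.vecMap_smul _ hk] at h1
  exact (right_smul_cancel (mt h.vecMap_eq_zero.1 ha₀) h1).symm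

theorem exists_iso (h : IsProperJordanIso γ) (ϕ : K →+* K') (hs : Function.Surjective ϕ)
    (hϕ : ∀ a x, vecMap γ (a <• x) = vecMap γ a <• ϕ x) (hstar : ∀ x, ϕ (star x) = star (ϕ x))
    (hscal : ∀ x : X.T, (γ x).scal = ϕ x.scal) : ∃ Φ : Iso X X', Φ.Induces γ := by
  refine ⟨{
    vec := { toFun := vecMap γ, invFun := vecMap γ.symm, left_inv := h.symm_vecMap
             right_inv := h.vecMap_symm, map_add' := h.vecMap_add }
    scal := RingEquiv.ofBijective ϕ ⟨ϕ.injective, hs⟩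
    map_smul := hϕ
    map_star := hstar
    map_K₀ := ?_
    map_q := ?_ }, fun x => ⟨h.map_vec x, hscal x⟩⟩
  · ext y
    constructor
    · rintro ⟨k, hk, rfl⟩
      change ϕ k ∈ X'.K₀
      rw [h.eq_scalMap hϕ hk]
      exact h.scalMap_mem hk
    · intro hy
      refine ⟨scalMap γ.symm y, h.symm.scalMap_mem hy, ?_⟩
      change ϕ _ = y
      rw [h.eq_scalMap hϕ (h.symm.scalMap_mem hy), h.scalMap_symm hy]
  · intro a
    change ϕ (X.q a) - X'.q (vecMap γ a) ∈ X'.K₀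
    have h1 := (γ (T.ofVec X a)).mem
    rw [hscal, h.map_vec] at h1
    rw [← neg_sub]
    exact neg_mem h1

end IsProperJordanIso

end PseudoQuadraticSpace

/-! ### The case of a proper involutory set. -/

namespace PseudoQuadraticSpace

open scoped RightActions

variable {K L K' L' : Type*}
  [DivisionRing K] [StarRing K] [AddCommGroup L] [Module Kᵐᵒᵖ L]
  [DivisionRing K'] [StarRing K'] [AddCommGroup L'] [Module K'ᵐᵒᵖ L']
  {X' : PseudoQuadraticSpace K' L'} {X : PseudoQuadraticSpace K L}

/-- If `K₀` were commutative, so would be `K`; then `σ` would be a homomorphism fixing generators,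
hence the identity. -/
theorem _root_.InvolutorySet.IsProperInvolutorySet.not_commute {S : InvolutorySet K}
    (hS : S.IsProperInvolutorySet) : ∃ k ∈ S.K₀, ∃ l ∈ S.K₀, k * l ≠ l * k := by
  by_contra hc
  push Not at hc
  obtain ⟨⟨x, hx⟩, hgen⟩ := hS
  have hcomm : ∀ y z : K, y * z = z * y := by
    intro y z
    have hy : y ∈ Subring.closure (S.K₀ : Set K) := hgen ▸ Subring.mem_top y
    have hz : z ∈ Subring.closure (S.K₀ : Set K) := hgen ▸ Subring.mem_top z
    induction hy, hz using Subring.closure_induction₂ with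
    | mem_mem x y hx hy => exact hc x hx y hy
    | zero_left => simp
    | zero_right => simp
    | one_left => simp
    | one_right => simp
    | neg_left _ _ _ _ h => rw [neg_mul, mul_neg, h]
    | neg_right _ _ _ _ h => rw [neg_mul, mul_neg, h]
    | add_left _ _ _ _ _ _ h1 h2 => rw [add_mul, mul_add, h1, h2]
    | add_right _ _ _ _ _ _ h1 h2 => rw [add_mul, mul_add, h1, h2]
    | mul_left x y z _ _ _ h1 h2 => rw [mul_assoc, h2, ← mul_assoc, h1, mul_assoc]
    | mul_right x y z _ _ _ h1 h2 => rw [← mul_assoc, h1, mul_assoc, h2, mul_assoc]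
  apply hx
  have hx' : x ∈ Subring.closure (S.K₀ : Set K) := hgen ▸ Subring.mem_top x
  clear hx
  induction hx' using Subring.closure_induction with
  | mem x hx => exact S.star_eq x hx
  | zero => simp
  | one => simp
  | add x y _ _ hx hy => rw [star_add, hx, hy]
  | neg x _ hx => rw [star_neg, hx]
  | mul x y _ _ hx hy => rw [star_mul, hx, hy, hcomm]

namespace IsProperJordanIso

/-- A Jordan isomorphism of proper pseudo-quadratic spaces is induced by an isomorphism if the
first involutory set is proper. -/
theorem exists_iso_of_isProperInvolutorySet {γ : X.T ≃* X'.T} (h : IsProperJordanIso γ)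
    (hS : X.toInvolutorySet.IsProperInvolutorySet) : ∃ Φ : Iso X X', Φ.Induces γ := by
  have hgen : ∀ x : K, x ∈ Subring.closure (X.K₀ : Set K) := fun x => hS.2 ▸ Subring.mem_top x
  have hP : ∀ x : K, ∃ y : K', ∀ a, vecMap γ (a <• x) = vecMap γ a <• y := fun x =>
    (Subring.closure_le (t := h.multipliers)).2 (fun _ hk => h.mem_multipliers hk) (hgen x)
  obtain ⟨ϕ, hϕ⟩ := h.exists_ringHom hP
  obtain ⟨k₁, hk₁, k₂, hk₂, hne⟩ := hS.not_commute
  have hK₀ : ∀ {k : K}, k ∈ X.K₀ → ϕ k = scalMap γ k := fun hk => h.eq_scalMap hϕ hk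
  have hstar : ∀ x, ϕ (star x) = star (ϕ x) := by
    intro x
    have hx := hgen x
    induction hx using Subring.closure_induction with
    | mem x hx => rw [X.star_eq x hx, hK₀ hx, X'.star_eq _ (h.scalMap_mem hx)]
    | zero => simp
    | one => simp
    | add x y _ _ hx hy => simp [hx, hy]
    | neg x _ hx => simp [hx]
    | mul x y _ _ hx hy => simp [hx, hy]
  -- The defect `c` satisfies `c ϕ(u) = ϕ(u)^σ c` for all `u`. For `u = k₁ k₂` this can be evaluated
  -- in two orders, which makes `k₁` and `k₂` commute unless `c = 0`.
  have hf : ∀ a b, X'.f (vecMap γ a) (vecMap γ b) = ϕ (X.f a b) := by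
    intro a b
    by_contra hc
    replace hc := sub_ne_zero.2 hc
    set c := X'.f (vecMap γ a) (vecMap γ b) - ϕ (X.f a b) with hc'
    have tr : ∀ u : K, c * ϕ u + star (c * ϕ u) = 0 := by
      intro u
      have h1 := h.scalMap_trace_f a (b <• u)
      rw [hϕ, X.f_smul_right, X'.f_smul_right, ← hK₀ (X.add_star_mem _), map_add, hstar,
        map_mul] at h1
      have e : c * ϕ u + star (c * ϕ u) =
          X'.f (vecMap γ a) (vecMap γ b) * ϕ u + star (X'.f (vecMap γ a) (vecMap γ b) * ϕ u)
          - (ϕ (X.f a b) * ϕ u + star (ϕ (X.f a b) * ϕ u)) := by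
        rw [hc', sub_mul, star_sub]
        abel
      rw [e, ← h1, sub_self]
    have hcs : star c = -c := by
      have := tr 1
      rw [map_one, mul_one] at this
      exact eq_neg_of_add_eq_zero_right this
    have hcu : ∀ u, c * ϕ u = star (ϕ u) * c := by
      intro u
      have := tr u
      rw [star_mul, hcs, mul_neg] at this
      exact sub_eq_zero.1 (by rw [sub_eq_add_neg]; exact this)
    have e1 := hcu (k₁ * k₂)
    rw [map_mul, ← mul_assoc, hcu, mul_assoc, hcu, ← mul_assoc, star_mul] at e1
    have e2 := mul_right_cancel₀ hc e1
    rw [← hstar, ← hstar, ← map_mul, ← map_mul, X.star_eq _ hk₁, X.star_eq _ hk₂] at e2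
    exact hne (ϕ.injective e2)
  have hsurj : Function.Surjective ϕ := by
    intro y
    obtain ⟨a₀, ha₀⟩ := @exists_ne L' h.proper'.nontrivial 0
    obtain ⟨b, rfl⟩ := f_surjective h.proper' ha₀ y
    refine ⟨X.f (vecMap γ.symm a₀) (vecMap γ.symm b), ?_⟩
    rw [← hf, h.vecMap_symm, h.vecMap_symm]
  refine h.exists_iso ϕ hsurj hϕ hstar fun x => ?_
  -- Polarizing this in `t ↦ t + k` gives `e ϕ(v) ϕ(k) = ϕ(k) ϕ(v) e` for the defect `e`. With `v =
  -- 1`, `e` commutes with `ϕ(K₀)`, so `e ≠ 0` would again make `k₁` and `k₂` commute.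
  have hn : ∀ z : X.T, ∀ v ∈ X.K₀,
      ϕ z.scal * ϕ v * star (ϕ z.scal) = (γ z).scal * ϕ v * star (γ z).scal := by
    intro z v hv
    rw [← hstar, ← map_mul, ← map_mul, hK₀ (X.mul_mul_star_mem _ hv), h.scalMap_conj z hv, hK₀ hv]
  by_contra hc
  set e := ϕ x.scal - (γ x).scal with he
  have he0 : e ≠ 0 := sub_ne_zero.2 fun h => hc h.symm
  have key : ∀ k ∈ X.K₀, ∀ v ∈ X.K₀, e * ϕ v * ϕ k + ϕ k * ϕ v * star e = 0 := by
    intro k hk v hv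
    have h1 := hn (x * T.ofK₀ ⟨k, hk⟩) v hv
    rw [T.mul_ofK₀_scal, h.map_mul_ofK₀_scal, ← hK₀ hk, map_add, star_add, star_add, ← hstar k,
      X.star_eq k hk] at h1
    have h2 := hn x v hv
    have h3 : (ϕ x.scal + ϕ k) * ϕ v * (star (ϕ x.scal) + ϕ k) -
        ((γ x).scal + ϕ k) * ϕ v * (star (γ x).scal + ϕ k) -
        (ϕ x.scal * ϕ v * star (ϕ x.scal) - (γ x).scal * ϕ v * star (γ x).scal) = 0 := by
      rw [h1, h2, sub_self, sub_self, sub_self]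
    rw [he, star_sub, ← h3]
    noncomm_ring
  have hse : star e = -e := by
    have := key 1 X.one_mem 1 X.one_mem
    simp only [map_one, mul_one, one_mul] at this
    exact eq_neg_of_add_eq_zero_right this
  have key' : ∀ k ∈ X.K₀, ∀ v ∈ X.K₀, e * ϕ v * ϕ k = ϕ k * ϕ v * e := by
    intro k hk v hv
    have := key k hk v hv
    rw [hse, mul_neg] at this
    exact sub_eq_zero.1 (by rw [sub_eq_add_neg]; exact this)
  have c1 := key' k₁ hk₁ 1 X.one_mem
  have c2 := key' k₂ hk₂ 1 X.one_mem
  have c3 := key' k₁ hk₁ k₂ hk₂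
  simp only [map_one, mul_one] at c1 c2
  rw [mul_assoc (ϕ k₁), ← c2, ← mul_assoc, ← c1, mul_assoc, mul_assoc, ← map_mul, ← map_mul] at c3
  exact hne (ϕ.injective (mul_left_cancel₀ he0 c3)).symm

end IsProperJordanIso

end PseudoQuadraticSpace

/-! ### Central `K₀`: linearizing the Hua identity. -/

namespace PseudoQuadraticSpace

open scoped RightActions

variable {K L K' L' : Type*}
  [DivisionRing K] [StarRing K] [AddCommGroup L] [Module Kᵐᵒᵖ L]
  [DivisionRing K'] [StarRing K'] [AddCommGroup L'] [Module K'ᵐᵒᵖ L']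
  {X' : PseudoQuadraticSpace K' L'} {X : PseudoQuadraticSpace K L}

/-- A Jordan isomorphism between proper pseudo-quadratic spaces for which `K₀` and `K₀'` are
central, and `K₀` has at least three elements. -/
structure IsCentralJordanIso (γ : X.T ≃* X'.T) : Prop extends IsProperJordanIso γ where
  central : X.toInvolutorySet.IsCentral
  central' : X'.toInvolutorySet.IsCentral
  exists_ne_one : ∃ k ∈ X.K₀, k ≠ 0 ∧ k ≠ 1

theorem right_smul_add {R M : Type*} [Ring R] [AddCommGroup M] [Module Rᵐᵒᵖ M] (a : M) (s t : R) :
    a <• (s + t) = a <• s + a <• t := by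
  rw [op_add, add_smul]

theorem right_smul_sub {R M : Type*} [Ring R] [AddCommGroup M] [Module Rᵐᵒᵖ M] (a : M) (s t : R) :
    a <• (s - t) = a <• s - a <• t := by
  rw [op_sub, sub_smul]

theorem right_smul_mul {R M : Type*} [Ring R] [AddCommGroup M] [Module Rᵐᵒᵖ M] (a : M) (s t : R) :
    a <• (s * t) = (a <• s) <• t := by
  rw [op_mul, mul_smul]

theorem right_smul_one {R M : Type*} [Ring R] [AddCommGroup M] [Module Rᵐᵒᵖ M] (a : M) :
    a <• (1 : R) = a := by
  rw [op_one, one_smul]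

/-- Comparison of the `k²` coefficients in `β (N + T k + k²) = Z + Y₁ k + Y₂ k²`, known only at `k =
0, 1, m`. -/
theorem eq_of_quadratic_relations {R M : Type*} [DivisionRing R] [AddCommGroup M] [Module Rᵐᵒᵖ M]
    {β Z Y₁ Y₂ : M} {N T m : R} (hm0 : m ≠ 0) (hm1 : m ≠ 1) (h0 : β <• N = Z)
    (h1 : β <• (N + T + 1) = Z + Y₁ + Y₂)
    (h2 : β <• (N + T * m + m * m) = Z + Y₁ <• m + Y₂ <• (m * m)) : β = Y₂ := by
  have hmm : m * m - m ≠ 0 := by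
    rw [← mul_sub_one]
    exact mul_ne_zero hm0 (sub_ne_zero.2 hm1)
  rw [right_smul_add, right_smul_add, h0, add_assoc, add_assoc] at h1 h2
  have e1 := add_left_cancel h1
  have e2 := add_left_cancel h2
  have e3 := congrArg (fun v => v <• m) e1
  simp only [smul_add] at e3
  rw [← right_smul_mul, right_smul_one] at e3
  have e4 : β <• (m * m - m) = Y₂ <• (m * m - m) := by
    rw [right_smul_sub, right_smul_sub]
    have := congrArg₂ (· - ·) e2 e3
    simpa using this
  rw [← sub_eq_zero, ← smul_sub] at e4
  rcases smul_eq_zero.1 e4 with h | h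
  · exact absurd ((op_eq_zero_iff _).1 h) hmm
  · exact sub_eq_zero.1 h

theorem _root_.InvolutorySet.IsCentral.inv_mul_mul_norm {S : InvolutorySet K} (hZ : S.IsCentral)
    (t u : K) : t⁻¹ * u * (t * star t) = star t * u := by
  by_cases h0 : t = 0
  · simp [h0]
  · rw [← hZ _ (S.mul_star_mem t), hZ.mul_star_comm, mul_assoc, mul_inv_cancel_left₀ h0]

theorem cubic_identity {R : Type*} [Ring R] {t u : R} (h : t * u = u * t) :
    u * (t - u) * u = u * (t * u + t * u - (t + u) * (t + u)) + (t + u) * (t * u) := by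
  have h' : ∀ z, t * (u * z) = u * (t * z) := fun z => by rw [← mul_assoc, h, mul_assoc]
  simp only [mul_add, add_mul, mul_sub, sub_mul, mul_assoc, h, h']
  abel

namespace IsCentralJordanIso

variable {γ : X.T ≃* X'.T}

theorem symm (h : IsCentralJordanIso γ) : IsCentralJordanIso γ.symm where
  toIsProperJordanIso := h.toIsProperJordanIso.symm
  central := h.central'
  central' := h.central
  exists_ne_one := by
    obtain ⟨k, hk, h0, h1⟩ := h.exists_ne_one
    refine ⟨scalMap γ k, h.scalMap_mem hk, mt (h.scalMap_eq_zero hk).1 h0, fun e => h1 ?_⟩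
    rw [← h.symm_scalMap hk, e, h.toIsProperJordanIso.symm.scalMap_one]

theorem mul_mem (h : IsCentralJordanIso γ) {k l : K} (hk : k ∈ X.K₀) (hl : l ∈ X.K₀) :
    k * l ∈ X.K₀ := h.central.mul_mem h.proper.star_ne hk hl

theorem scalMap_mul (h : IsCentralJordanIso γ) {k l : K} (hk : k ∈ X.K₀) (hl : l ∈ X.K₀) :
    scalMap γ (k * l) = scalMap γ k * scalMap γ l := by
  obtain ⟨a₀, ha₀⟩ := @exists_ne L h.proper.nontrivial 0
  have h1 := h.vecMap_smul a₀ (h.mul_mem hk hl)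
  rw [right_smul_mul, h.vecMap_smul _ hl, h.vecMap_smul _ hk, ← right_smul_mul] at h1
  exact (right_smul_cancel (mt h.vecMap_eq_zero.1 ha₀) h1).symm

/-- Multiplying by the central norm `t t^σ` clears `t⁻¹`, so the identity becomes polynomial in `t`
and can be polarized. -/
theorem vecMap_hua_norm (h : IsCentralJordanIso γ) (x : X.T) (b : L) :
    vecMap γ (b <• star x.scal) <• ((γ x).scal * star (γ x).scal) -
        vecMap γ (x.vec <• (star x.scal * X.f x.vec b * star x.scal)) =
      (vecMap γ b <• star (γ x).scal) <• ((γ x).scal * star (γ x).scal) -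
        vecMap γ x.vec <• (star (γ x).scal * X'.f (vecMap γ x.vec) (vecMap γ b) *
          star (γ x).scal) := by
  have h1 := congrArg (fun v => v <• ((γ x).scal * star (γ x).scal)) (h.vecMap_hua x b)
  beta_reduce at h1
  have hN := X.mul_star_mem x.scal
  conv at h1 => lhs; rw [← h.scalMap_norm, ← h.vecMap_smul _ hN]
  rw [smul_sub, smul_sub, ← right_smul_mul x.vec, ← right_smul_mul (vecMap γ x.vec),
    mul_assoc x.scal⁻¹, mul_assoc (γ x).scal⁻¹, h.central.inv_mul_mul_norm,
    h.central'.inv_mul_mul_norm, h.vecMap_sub, h.vecMap_smul _ hN, h.scalMap_norm] at h1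
  rw [mul_assoc, mul_assoc]
  exact h1

/-- This is the case `b = a`: since `f(a,a) = t - t^σ`, `cubic_identity` makes everything linear in
`t^σ` with central coefficients. -/
theorem smul_scal_defect (h : IsCentralJordanIso γ) (x : X.T) :
    (vecMap γ (x.vec <• star x.scal) - vecMap γ x.vec <• star (γ x).scal) <•
      (((γ x).scal + star (γ x).scal) * ((γ x).scal + star (γ x).scal) -
        (γ x).scal * star (γ x).scal) = 0 := by
  have h1 := h.vecMap_hua_norm x x.vec
  rw [← h.map_vec x, (γ x).f_self, x.f_self, h.map_vec x,
    cubic_identity (h.central.mul_star_comm _), cubic_identity (h.central'.mul_star_comm _),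
    right_smul_add, right_smul_add, h.vecMap_add] at h1
  have hN := X.mul_star_mem x.scal
  have hT := X.add_star_mem x.scal
  have hTT := h.mul_mem hT hT
  rw [h.vecMap_smul _ (h.mul_mem hT hN), h.scalMap_mul hT hN, h.scalMap_trace, h.scalMap_norm,
    ← sub_sub, ← sub_sub, sub_left_inj, right_smul_mul x.vec,
    h.vecMap_smul _ (sub_mem (add_mem hN hN) hTT), sub_eq_add_neg (x.scal * _ + _),
    h.scalMap_add (add_mem hN hN) (neg_mem hTT), h.scalMap_add hN hN, h.scalMap_neg hTT,
    h.scalMap_mul hT hT, h.scalMap_trace, h.scalMap_norm, right_smul_mul (vecMap γ x.vec),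
    ← right_smul_sub, ← sub_eq_add_neg, ← right_smul_sub] at h1
  rw [smul_sub, sub_eq_zero]
  convert h1 using 3 <;> abel

/-- `γ(a t) = γ(a) s` if `γ(a, t) = (γ(a), s)`. -/
theorem vecMap_smul_scal (h : IsCentralJordanIso γ) (x : X.T) :
    vecMap γ (x.vec <• x.scal) = vecMap γ x.vec <• (γ x).scal := by
  have hT : vecMap γ (x.vec <• x.scal) + vecMap γ (x.vec <• star x.scal) =
      vecMap γ x.vec <• (γ x).scal + vecMap γ x.vec <• star (γ x).scal := by
    rw [← h.vecMap_add, ← right_smul_add, ← right_smul_add, h.vecMap_smul _ (X.add_star_mem _),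
      h.scalMap_trace]
  suffices hs : vecMap γ (x.vec <• star x.scal) = vecMap γ x.vec <• star (γ x).scal by
    rw [hs] at hT
    exact add_right_cancel hT
  by_contra hc
  replace hc := sub_ne_zero.2 hc
  set s := (γ x).scal with hs
  have cancel : ∀ {y : K'}, (vecMap γ (x.vec <• star x.scal) - vecMap γ x.vec <• star s) <• y = 0 →
      y = 0 := by
    intro y hy
    exact (op_eq_zero_iff _).1 ((smul_eq_zero.1 hy).resolve_right hc)
  have p0 := cancel (h.smul_scal_defect x)
  -- Replacing `t` by `t + k` leaves the defect unchanged and adds `3 k (T + k)` to the factor `T² -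
  -- N`. Two nonzero values of `k` then force characteristic 3.
  have pk : ∀ k ∈ X.K₀, 3 * scalMap γ k * (s + star s + scalMap γ k) = 0 := by
    intro k hk
    have hk' := X'.star_eq _ (h.scalMap_mem hk)
    have h1 := h.smul_scal_defect (x * T.ofK₀ ⟨k, hk⟩)
    rw [T.mul_ofK₀_vec, T.mul_ofK₀_scal, h.map_mul_ofK₀_scal, star_add, star_add, hk',
      X.star_eq k hk, right_smul_add, right_smul_add, h.vecMap_add, h.vecMap_smul _ hk,
      add_sub_add_right_eq_sub] at h1
    have h2 := cancel h1
    rw [← hs] at h2 p0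
    have h3 := congrArg₂ (· - ·) h2 p0
    simp only [sub_zero] at h3
    rw [← h3]
    have c1 := h.central' _ (h.scalMap_mem hk) s
    have c2 := h.central' _ (h.scalMap_mem hk) (star s)
    simp only [mul_add, add_mul, c1, c2]
    noncomm_ring
    rw [c1, c2]
    abel
  obtain ⟨k, hk, hk0, hk1⟩ := h.exists_ne_one
  have hk0' : scalMap γ k ≠ 0 := mt (h.scalMap_eq_zero hk).1 hk0
  have hk1' : scalMap γ k ≠ 1 := fun e => hk1 (by
    rw [← h.symm_scalMap hk, e, h.toIsProperJordanIso.symm.scalMap_one])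
  have p1 := pk 1 X.one_mem
  have p2 := pk k hk
  rw [h.scalMap_one, mul_one] at p1
  have h3 : (3 : K') = 0 := by
    by_contra h3
    have q1 := (mul_eq_zero.1 p1).resolve_left h3
    have q2 := (mul_eq_zero.1 p2).resolve_left (mul_ne_zero h3 hk0')
    exact hk1' (add_left_cancel (q2.trans q1.symm))
  have hsc := h.central'.mul_star_comm s
  -- In characteristic 3 the vanishing `T² - N` equals `T² - 4N = (s - s^σ)²`. So `s = s^σ = -(s +
  -- s^σ)` lies in `K₀'`, and anisotropy gives `a' = 0`.
  have hd : (s - star s) * (s - star s) = 0 := by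
    have e : (s - star s) * (s - star s) =
        (s + star s) * (s + star s) - s * star s - 3 * (s * star s) +
          2 * (s * star s - star s * s) := by
      noncomm_ring
    rw [e, p0, h3, hsc]
    simp
  have hss : star s = s := (sub_eq_zero.1 (mul_self_eq_zero.1 hd)).symm
  have hsK : s ∈ X'.K₀ := by
    have e : s = -(s + star s) := by
      have e3 : s + (s + s) = 3 * s := by noncomm_ring
      rw [hss, eq_neg_iff_add_eq_zero, e3, h3, zero_mul]
    rw [e]
    exact neg_mem (X'.add_star_mem s)
  have ha : (γ x).vec = 0 := by
    rw [← X'.q_mem_iff]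
    have := add_mem (γ x).mem hsK
    rwa [sub_add_cancel] at this
  rw [h.map_vec, h.vecMap_eq_zero] at ha
  apply hc
  rw [ha, smul_zero, h.vecMap_zero, smul_zero, sub_zero]

/-- Polarized form of the compatibility of `γ` with the Hua maps. -/
theorem vecMap_star_smul_sub (h : IsCentralJordanIso γ) (x : X.T) (b : L) :
    vecMap γ (b <• star x.scal) - vecMap γ b <• star (γ x).scal =
      vecMap γ (x.vec <• X.f x.vec b) -
        vecMap γ x.vec <• X'.f (vecMap γ x.vec) (vecMap γ b) := by
  obtain ⟨m, hm, hm0, hm1⟩ := h.exists_ne_one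
  have hm0' : scalMap γ m ≠ 0 := mt (h.scalMap_eq_zero hm).1 hm0
  have hm1' : scalMap γ m ≠ 1 := fun e => hm1 (by
    rw [← h.symm_scalMap hm, e, h.toIsProperJordanIso.symm.scalMap_one])
  set a := x.vec with ha
  set t := x.scal with ht
  set s := (γ x).scal with hs
  set f := X.f a b with hf
  set f' := X'.f (vecMap γ a) (vecMap γ b) with hf'
  -- The identity for `(a, t + k)`, sorted by powers of `k`; the claim is its `k²` coefficient.
  have key : ∀ k ∈ X.K₀,
      (vecMap γ (b <• star t) - vecMap γ b <• star s) <•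
        (s * star s + (s + star s) * scalMap γ k + scalMap γ k * scalMap γ k) =
      vecMap γ (a <• (star t * f * star t)) - vecMap γ a <• (star s * f' * star s) +
      (vecMap γ (a <• (f * star t + star t * f)) - vecMap γ a <• (f' * star s + star s * f')) <•
        scalMap γ k +
      (vecMap γ (a <• f) - vecMap γ a <• f') <• (scalMap γ k * scalMap γ k) := by
    intro k hk
    have hk' := X'.star_eq _ (h.scalMap_mem hk)
    have h1 := h.vecMap_hua_norm (x * T.ofK₀ ⟨k, hk⟩) b
    rw [T.mul_ofK₀_vec, T.mul_ofK₀_scal, h.map_mul_ofK₀_scal, star_add, star_add, hk',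
      X.star_eq k hk, ← ha, ← ht, ← hs, ← hf, ← hf'] at h1
    have e1 : (star t + k) * f * (star t + k) =
        star t * f * star t + (f * star t + star t * f) * k + f * (k * k) := by
      have c1 := h.central _ hk f
      have c2 : k * (f * star t) = f * star t * k := h.central _ hk _
      have c3 : k * (f * k) = f * (k * k) := by rw [h.central _ hk, mul_assoc]
      simp only [add_mul, mul_add, mul_assoc] at c2 c3 ⊢
      rw [c2, c3]
      abel
    have hkk := h.scalMap_mem hk
    have e2 : (star s + scalMap γ k) * f' * (star s + scalMap γ k) =
        star s * f' * star s + (f' * star s + star s * f') * scalMap γ k +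
          f' * (scalMap γ k * scalMap γ k) := by
      have c2 : scalMap γ k * (f' * star s) = f' * star s * scalMap γ k := h.central' _ hkk _
      have c3 : scalMap γ k * (f' * scalMap γ k) = f' * (scalMap γ k * scalMap γ k) := by
        rw [h.central' _ hkk, mul_assoc]
      simp only [add_mul, mul_add, mul_assoc] at c2 c3 ⊢
      rw [c2, c3]
      abel
    have e3 : (s + scalMap γ k) * (star s + scalMap γ k) =
        s * star s + (s + star s) * scalMap γ k + scalMap γ k * scalMap γ k := by
      rw [mul_add, add_mul, h.central' _ hkk (star s)]
      noncomm_ring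
    rw [e1, e2, e3, right_smul_add b, right_smul_add (vecMap γ b), h.vecMap_add,
      h.vecMap_smul b hk, right_smul_add a, right_smul_add a, h.vecMap_add, h.vecMap_add,
      right_smul_mul a _ k, h.vecMap_smul _ hk, right_smul_mul a f,
      h.vecMap_smul _ (h.mul_mem hk hk), h.scalMap_mul hk hk, right_smul_add (vecMap γ a),
      right_smul_add (vecMap γ a), right_smul_mul (vecMap γ a) (_ + _),
      right_smul_mul (vecMap γ a) f'] at h1
    simp only [smul_add, smul_sub] at h1 ⊢
    rw [← sub_eq_zero] at h1 ⊢
    rw [← h1]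
    abel
  have k0 := key 0 X.K₀.zero_mem
  have k1 := key 1 X.one_mem
  have km := key m hm
  simp only [h.scalMap_zero, mul_zero, op_zero, zero_smul, add_zero] at k0
  simp only [h.scalMap_one, mul_one, op_one, one_smul] at k1
  exact eq_of_quadratic_relations hm0' hm1' k0 k1 km

theorem vecMap_smul_add (h : IsCentralJordanIso γ) (x : X.T) (b : L) :
    vecMap γ (b <• x.scal) + vecMap γ (x.vec <• X.f x.vec b) =
      vecMap γ b <• (γ x).scal +
        vecMap γ x.vec <• X'.f (vecMap γ x.vec) (vecMap γ b) := by
  have hT : vecMap γ (b <• x.scal) + vecMap γ (b <• star x.scal) =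
      vecMap γ b <• (γ x).scal + vecMap γ b <• star (γ x).scal := by
    rw [← h.vecMap_add, ← right_smul_add, ← right_smul_add, h.vecMap_smul _ (X.add_star_mem _),
      h.scalMap_trace]
  have h1 := h.vecMap_star_smul_sub x b
  have h2 := congrArg₂ (· - ·) hT h1
  beta_reduce at h2
  rw [← sub_eq_zero] at h2 ⊢
  rw [← h2]
  abel

end IsCentralJordanIso

end PseudoQuadraticSpace

/-! ### Skew elements `t j = j t^σ` and the images of the vectors `a j`. -/

namespace InvolutorySet.IsCentral

variable {K : Type*} [DivisionRing K] [StarRing K] {S : InvolutorySet K}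

/-- Skewness amounts to trace-orthogonality to `1` and `t`. In this form it passes through `γ`,
which preserves traces of `f`. -/
theorem skew_of_trace (hZ : S.IsCentral) {t w : K} (h0 : w + star w = 0)
    (h1 : star t * w + star (star t * w) = 0) : t * w = w * star t := by
  have hw : star w = -w := eq_neg_of_add_eq_zero_right h0
  rw [star_mul, star_star, hw, neg_mul, ← sub_eq_add_neg, sub_eq_zero] at h1
  have h2 := hZ _ (S.add_star_mem t) w
  rw [add_mul, mul_add, h1, add_comm] at h2
  exact add_left_cancel h2

theorem trace_of_skew (hZ : S.IsCentral) {t w : K} (ht : star t ≠ t) (h : t * w = w * star t) :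
    w + star w = 0 ∧ star t * w + star (star t * w) = 0 := by
  have hw := hZ.star_of_skew ht h
  refine ⟨by rw [hw, add_neg_cancel], ?_⟩
  rw [star_mul, star_star, hw, neg_mul, hZ.skew_mul h, add_neg_cancel]

theorem skew_div (hZ : S.IsCentral) {t i j : K} (hi : i ≠ 0) (hi' : t * i = i * star t)
    (hj : t * j = j * star t) : i⁻¹ * j * t = t * (i⁻¹ * j) := by
  have h1 : t * i⁻¹ = i⁻¹ * star t := by
    have := hZ.skew_mul hi'
    rw [eq_inv_mul_iff_mul_eq₀ hi, ← mul_assoc, this, mul_inv_cancel_right₀ hi]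
  rw [mul_assoc, hZ.skew_mul hj, ← mul_assoc, ← h1, mul_assoc]

end InvolutorySet.IsCentral

namespace PseudoQuadraticSpace

open scoped RightActions

variable {K L K' L' : Type*}
  [DivisionRing K] [StarRing K] [AddCommGroup L] [Module Kᵐᵒᵖ L]
  [DivisionRing K'] [StarRing K'] [AddCommGroup L'] [Module K'ᵐᵒᵖ L']
  {X' : PseudoQuadraticSpace K' L'} {X : PseudoQuadraticSpace K L}

/-- The element `(a c, c^σ t c)` of `T`, for `(a, t) ∈ T` and `c ∈ K`. -/
def T.smul (x : X.T) (c : K) : X.T where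
  vec := x.vec <• c
  scal := star c * x.scal * c
  mem := by
    have h := add_mem (X.q_smul x.vec c) (X.conj_mem c _ x.mem)
    convert h using 1
    noncomm_ring

theorem T.smul_vec (x : X.T) (c : K) : (x.smul c).vec = x.vec <• c := rfl

theorem T.smul_scal (x : X.T) (c : K) : (x.smul c).scal = star c * x.scal * c := rfl

/-- Some `(a, t) ∈ T` satisfies `t^σ ≠ t`. -/
theorem exists_star_scal_ne (hX : X.IsProper) : ∃ x : X.T, star x.scal ≠ x.scal := by
  by_contra hc
  push Not at hc
  -- Otherwise `f` is alternating, so `f(a,b)^σ = -f(b,a) = f(a,b)`, although `f(a, ·)` is onto `K`.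
  have hf : ∀ a, X.f a a = 0 := fun a => by
    have h1 := hc (T.ofVec X a)
    have h2 := (T.ofVec X a).f_self
    rw [h1, sub_self] at h2
    exact h2
  obtain ⟨y, hy⟩ := hX.star_ne
  obtain ⟨a, ha⟩ := @exists_ne L hX.nontrivial 0
  obtain ⟨b, rfl⟩ := f_surjective hX ha y
  apply hy
  have h1 := hf (a + b)
  rw [X.f_add_left, X.f_add_right, X.f_add_right, hf, hf, zero_add, add_zero] at h1
  rw [X.star_f]
  exact neg_eq_of_add_eq_zero_left h1

namespace IsCentralJordanIso

variable {γ : X.T ≃* X'.T}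

/-- The square `(t - t^σ)² = T² - 4N` is a polynomial in trace and norm, which `scalMap` respects.
-/
theorem star_scal_ne (h : IsCentralJordanIso γ) {x : X.T} (hx : star x.scal ≠ x.scal) :
    star (γ x).scal ≠ (γ x).scal := by
  intro hs
  have e : ∀ {t u : K}, t * u = u * t →
      (t - u) * (t - u) = (t + u) * (t + u) + -(t * u + t * u + (t * u + t * u)) := by
    intro t u htu
    simp only [mul_add, add_mul, mul_sub, sub_mul, htu]
    abel
  have e' : ∀ {t : K'}, (t + t) * (t + t) + -(t * t + t * t + (t * t + t * t)) = 0 := by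
    intro t
    simp only [mul_add, add_mul]
    abel
  have hN := X.mul_star_mem x.scal
  have hT := X.add_star_mem x.scal
  have hNN := add_mem hN hN
  have hm := add_mem (h.mul_mem hT hT) (neg_mem (add_mem hNN hNN))
  have h1 := e (h.central.mul_star_comm x.scal)
  have h2 : scalMap γ ((x.scal - star x.scal) * (x.scal - star x.scal)) = 0 := by
    rw [h1, h.scalMap_add (h.mul_mem hT hT) (neg_mem (add_mem hNN hNN)), h.scalMap_mul hT hT,
      h.scalMap_neg (add_mem hNN hNN), h.scalMap_add hNN hNN, h.scalMap_add hN hN, h.scalMap_trace,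
      h.scalMap_norm, hs, e']
  rw [h.scalMap_eq_zero (h1 ▸ hm), mul_self_eq_zero, sub_eq_zero] at h2
  exact hx h2.symm

/-- `γ` preserves the orthogonal complement of `a K₀ + a t K₀` with respect to the trace of `f`. -/
theorem skew_f (h : IsCentralJordanIso γ) {x : X.T} (hx : star x.scal ≠ x.scal) {b : L}
    (hb : x.scal * X.f x.vec b = X.f x.vec b * star x.scal) :
    (γ x).scal * X'.f (vecMap γ x.vec) (vecMap γ b) =
      X'.f (vecMap γ x.vec) (vecMap γ b) * star (γ x).scal := by
  obtain ⟨h1, h2⟩ := h.central.trace_of_skew hx hb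
  apply h.central'.skew_of_trace
  · rw [← h.scalMap_trace_f, h1, h.scalMap_zero]
  · rw [← X'.f_smul_left, ← h.vecMap_smul_scal, ← h.scalMap_trace_f, X.f_smul_left, h2,
      h.scalMap_zero]

theorem smul_of_smul_star (h : IsCentralJordanIso γ) {x : X.T} {b : L} {u : K'}
    (hb : vecMap γ (b <• star x.scal) = vecMap γ b <• u) :
    vecMap γ (b <• x.scal) = vecMap γ b <• ((γ x).scal + star (γ x).scal - u) := by
  have e : x.scal = x.scal + star x.scal - star x.scal := by abel
  conv_lhs => rw [e]
  rw [right_smul_sub, h.vecMap_sub, h.vecMap_smul _ (X.add_star_mem _), h.scalMap_trace, hb,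
    ← right_smul_sub]

/-- With `b = a j`, the left side of `vecMap_smul_add` collapses because `j t + (t - t^σ) j = t j =
j t^σ`. -/
theorem vecMap_skew_smul_star (h : IsCentralJordanIso γ) (x : X.T) {j : K}
    (hj : x.scal * j = j * star x.scal) :
    vecMap γ ((x.vec <• j) <• star x.scal) = vecMap γ (x.vec <• j) <• (γ x).scal +
      vecMap γ x.vec <• X'.f (vecMap γ x.vec) (vecMap γ (x.vec <• j)) := by
  rw [← h.vecMap_smul_add, ← h.vecMap_add, ← right_smul_mul, ← right_smul_mul, ← right_smul_add,
    X.f_smul_right, x.f_self, h.central.skew_mul hj, sub_mul, ← hj]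
  congr 3
  abel

theorem skew_f_self (h : IsCentralJordanIso γ) (x : X.T) {j : K}
    (hj : x.scal * j = j * star x.scal) :
    x.scal * X.f x.vec (x.vec <• j) = X.f x.vec (x.vec <• j) * star x.scal := by
  rw [X.f_smul_right, x.f_self, mul_assoc, ← hj, ← mul_assoc, ← mul_assoc, mul_sub, sub_mul,
    h.central.mul_star_comm, sub_mul, sub_mul]

/-- For `t j = j t^σ`, either `γ(a j) ∈ γ(a) K'`, or `γ(a j)` is orthogonal to `γ(a)`:
the first case. -/
theorem exists_skew_of_f_ne_zero (h : IsCentralJordanIso γ) {x : X.T}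
    (hx : star x.scal ≠ x.scal) {j : K} (hj : x.scal * j = j * star x.scal)
    (hf : X'.f (vecMap γ x.vec) (vecMap γ (x.vec <• j)) ≠ 0) :
    ∃ j', (γ x).scal * j' = j' * star (γ x).scal ∧
      vecMap γ (x.vec <• j) = vecMap γ x.vec <• j' ∧
      vecMap γ ((x.vec <• j) <• x.scal) = vecMap γ (x.vec <• j) <• (γ x).scal := by
  have hj0 : j ≠ 0 := by
    rintro rfl
    apply hf
    rw [op_zero, zero_smul, h.vecMap_zero, X'.f_zero_right]
  have hs := h.star_scal_ne hx
  have hc := h.skew_f hx (h.skew_f_self x hj)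
  have hb := h.vecMap_skew_smul_star x hj
  set b := x.vec <• j with hbdef
  set c := X'.f (vecMap γ x.vec) (vecMap γ b) with hcdef
  set s := (γ x).scal with hsdef
  -- The element `(a j, j^σ t j)` of `T` has scalar `t^σ (j^σ j)`, a central multiple of `t^σ`, so
  -- `vecMap_smul_scal` applies.
  obtain ⟨u, hu⟩ : ∃ u, vecMap γ (b <• star x.scal) = vecMap γ b <• u := by
    have h1 := h.vecMap_smul_scal (x.smul j)
    have hn := X.star_mul_mem j
    have hn0 : star j * j ≠ 0 := mul_ne_zero (by simpa using hj0) hj0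
    have e : star j * x.scal * j = star x.scal * (star j * j) := by
      rw [mul_assoc, hj, ← mul_assoc, h.central _ hn]
    rw [T.smul_vec, T.smul_scal, e, right_smul_mul, h.vecMap_smul _ hn, ← hbdef] at h1
    refine ⟨(γ (x.smul j)).scal * (scalMap γ (star j * j))⁻¹, ?_⟩
    have hn0' := mt (h.scalMap_eq_zero hn).1 hn0
    rw [right_smul_mul, ← h1, ← right_smul_mul (vecMap γ _), mul_inv_cancel₀ hn0', right_smul_one]
  rw [hu] at hb
  -- Pairing `b' u = b' s + a' c` with `a'` identifies `u` as `s^σ`; then `b' (s^σ - s) = a' c` puts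
  -- `b'` in `a' K'`.
  have hcu : c * u = c * star s := by
    have h1 := congrArg (X'.f (vecMap γ x.vec)) hb
    rw [X'.f_add_right, X'.f_smul_right, X'.f_smul_right, X'.f_smul_right, ← h.map_vec,
      (γ x).f_self, h.map_vec, ← hcdef, ← hsdef, sub_mul, ← h.central'.skew_mul hc, hc] at h1
    rw [h1]
    abel
  have hu' : u = star s := mul_left_cancel₀ hf hcu
  rw [hu'] at hb hu
  have hd : star s - s ≠ 0 := sub_ne_zero.2 hs
  refine ⟨c * (star s - s)⁻¹, ?_, ?_, ?_⟩
  · have h1 : Commute (star s - s) (star s) := by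
      have : star s * s = s * star s := (h.central'.mul_star_comm s).symm
      change (star s - s) * star s = star s * (star s - s)
      rw [sub_mul, mul_sub, this]
    rw [← mul_assoc, hc, mul_assoc, mul_assoc, h1.inv_left₀.eq]
  · rw [right_smul_mul, ← sub_eq_iff_eq_add'.2 hb, ← right_smul_sub, ← right_smul_mul,
      mul_inv_cancel₀ hd, right_smul_one]
  · rw [h.smul_of_smul_star hu, add_sub_cancel_right]

/-- The second case of the alternative in `exists_skew_of_f_ne_zero`. -/
theorem smul_star_of_f_eq_zero (h : IsCentralJordanIso γ) {x : X.T} {j : K}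
    (hj : x.scal * j = j * star x.scal)
    (hf : X'.f (vecMap γ x.vec) (vecMap γ (x.vec <• j)) = 0) :
    vecMap γ ((x.vec <• j) <• star x.scal) = vecMap γ (x.vec <• j) <• (γ x).scal := by
  rw [h.vecMap_skew_smul_star x hj, hf, op_zero, zero_smul, add_zero]

end IsCentralJordanIso

end PseudoQuadraticSpace

/-! ### Obstructions and why they cannot occur. -/

namespace PseudoQuadraticSpace

open scoped RightActions

variable {K L K' L' : Type*}
  [DivisionRing K] [StarRing K] [AddCommGroup L] [Module Kᵐᵒᵖ L]
  [DivisionRing K'] [StarRing K'] [AddCommGroup L'] [Module K'ᵐᵒᵖ L']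
  {X' : PseudoQuadraticSpace K' L'} {X : PseudoQuadraticSpace K L}

namespace IsCentralJordanIso

/-- A vector `c` orthogonal to `a` whose image is `γ(a) j'` with `s j' = j' s^σ`. -/
structure IsObstruction (γ : X.T ≃* X'.T) (x : X.T) (j' : K') (c : L) : Prop where
  star_ne : star x.scal ≠ x.scal
  ne_zero : j' ≠ 0
  skew : (γ x).scal * j' = j' * star (γ x).scal
  map_eq : vecMap γ c = vecMap γ x.vec <• j'
  f_eq_zero : X.f x.vec c = 0

variable {γ : X.T ≃* X'.T}

theorem IsObstruction.smul_scal (h : IsCentralJordanIso γ) {x : X.T} {j' : K'} {c : L}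
    (ho : IsObstruction γ x j' c) :
    vecMap γ (c <• x.scal) = vecMap γ c <• star (γ x).scal := by
  have h1 := h.vecMap_smul_add x c
  rw [ho.f_eq_zero, op_zero, zero_smul, h.vecMap_zero, add_zero] at h1
  rw [h1, ho.map_eq, X'.f_smul_right, ← h.map_vec, (γ x).f_self, ← right_smul_mul,
    ← right_smul_mul, ← right_smul_add, sub_mul, ← h.central'.skew_mul ho.skew, ho.skew,
    add_sub_cancel]

/-- Modulo `K₀'`, `q'(c') = q'(a' j')` is `j'^σ s j' = s^σ (j'^σ j')`. As `t` acts on `c` the way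
`s^σ` acts on `c'`, this pulls back to a formula for `q(c)`. -/
theorem IsObstruction.exists_scal_eq (h : IsCentralJordanIso γ) {x : X.T} {j' : K'} {c : L}
    (ho : IsObstruction γ x j' c) : ∃ β ∈ X.K₀, ∃ k ∈ X.K₀, scalMap γ β = star j' * j' ∧
      X.q c = x.scal * β + k ∧
      (γ (T.ofVec X c)).scal = star (γ x).scal * scalMap γ β + scalMap γ k := by
  have hn := X'.star_mul_mem j'
  have hk : (γ (T.ofVec X c)).scal - star j' * (γ x).scal * j' ∈ X'.K₀ := by
    have h1 := (γ (T.ofVec X c)).mem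
    have h2 := ((γ x).smul j').mem
    rw [T.smul_vec, T.smul_scal, h.map_vec, ← ho.map_eq] at h2
    rw [h.map_vec] at h1
    change X'.q (vecMap γ c) - _ ∈ X'.K₀ at h1
    have h3 := sub_mem h2 h1
    rwa [sub_sub_sub_cancel_left] at h3
  have e : star j' * (γ x).scal * j' = star (γ x).scal * (star j' * j') := by
    rw [mul_assoc, ho.skew, ← mul_assoc, h.central' _ hn]
  rw [e] at hk
  set k' := (γ (T.ofVec X c)).scal - star (γ x).scal * (star j' * j') with hk'
  have hβ' := h.toIsProperJordanIso.scalMap_symm hn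
  have hk'' := h.toIsProperJordanIso.scalMap_symm hk
  have hβm := h.toIsProperJordanIso.symm.scalMap_mem hn
  have hkm := h.toIsProperJordanIso.symm.scalMap_mem hk
  have e2 : (γ (T.ofVec X c)).scal = star (γ x).scal * (star j' * j') + k' := by
    rw [hk', add_sub_cancel]
  refine ⟨_, hβm, _, hkm, hβ', ?_, by rw [hβ', hk'', e2]⟩
  have hc : c ≠ 0 := by
    intro h0
    have h1 := ho.map_eq
    rw [h0, h.vecMap_zero] at h1
    rcases smul_eq_zero.1 h1.symm with h2 | h2
    · exact ho.ne_zero ((op_eq_zero_iff _).1 h2)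
    · rw [h.vecMap_eq_zero] at h2
      have h3 := x.f_self
      rw [h2, X.f_zero_left] at h3
      exact ho.star_ne (sub_eq_zero.1 h3.symm).symm
  have h1 := h.vecMap_smul_scal (T.ofVec X c)
  change vecMap γ (c <• X.q c) = vecMap γ c <• _ at h1
  apply right_smul_cancel hc
  apply h.vecMap_injective
  rw [h1, e2, right_smul_add, right_smul_mul, right_smul_add, right_smul_mul c, h.vecMap_add,
    h.vecMap_smul _ hβm, h.vecMap_smul _ hkm, ho.smul_scal h, hβ', hk'']

theorem IsObstruction.f_self_ne_zero (h : IsCentralJordanIso γ) {x : X.T} {j' : K'} {c : L}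
    (ho : IsObstruction γ x j' c) : X.f c c ≠ 0 := by
  obtain ⟨β, hβ, k, hk, e1, e2, -⟩ := ho.exists_scal_eq h
  have hβ0 : β ≠ 0 := by
    rintro rfl
    rw [h.scalMap_zero] at e1
    rcases mul_eq_zero.1 e1.symm with h2 | h2
    · exact ho.ne_zero (by simpa using h2)
    · exact ho.ne_zero h2
  rw [X.f_self, e2, star_add, star_mul, X.star_eq β hβ, X.star_eq k hk, h.central β hβ,
    add_sub_add_right_eq_sub, ← sub_mul]
  exact mul_ne_zero (sub_ne_zero.2 fun e => ho.star_ne e.symm) hβ0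

/-- The element `w = f'(c', d')` commutes with `s` as a product of two skew elements, yet is skew
for `s^σ β' + k'`, so `w = 0`; hence also `f'(a', d') = 0`. Then `d t` maps to `d' s` via `a`, but
to `d' s^σ` via `c`, which forces `d = 0`. -/
theorem IsObstruction.eq_zero_of_orthogonal (h : IsCentralJordanIso γ) {x : X.T} {j' : K'}
    {c d : L} (ho : IsObstruction γ x j' c) (had : X.f x.vec d = 0) (hcd : X.f c d = 0) :
    d = 0 := by
  by_contra hd
  have hs := h.star_scal_ne ho.star_ne
  obtain ⟨β, hβ, k, hk, e1, e2, e3⟩ := ho.exists_scal_eq h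
  have hn0 : star j' * j' ≠ 0 := mul_ne_zero (by simpa using ho.ne_zero) ho.ne_zero
  set s := (γ x).scal with hsdef
  have hu := h.skew_f ho.star_ne (b := d) (by rw [had, mul_zero, zero_mul])
  set u := X'.f (vecMap γ x.vec) (vecMap γ d) with hudef
  have hw : X'.f (vecMap γ c) (vecMap γ d) = star j' * u := by
    rw [ho.map_eq, X'.f_smul_left]
  have hj' := h.central'.star_of_skew hs ho.skew
  have hcomm : star j' * u * s = s * (star j' * u) := by
    rw [hj', mul_assoc, h.central'.skew_mul hu, neg_mul, neg_mul, mul_neg, ← mul_assoc, ← ho.skew,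
      mul_assoc]
  have hw0 : star j' * u = 0 := by
    set w := star j' * u with hwdef
    have t0 : w + star w = 0 := by
      rw [← hw, ← h.scalMap_trace_f, hcd, star_zero, add_zero, h.scalMap_zero]
    have t1 : star (γ (T.ofVec X c)).scal * w + star (star (γ (T.ofVec X c)).scal * w) = 0 := by
      have h1 := h.vecMap_smul_scal (T.ofVec X c)
      change vecMap γ (c <• X.q c) = vecMap γ c <• _ at h1
      rw [← hw, ← X'.f_smul_left, ← h1, ← h.scalMap_trace_f, X.f_smul_left, hcd, mul_zero,
        star_zero, add_zero, h.scalMap_zero]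
    have h2 := h.central'.skew_of_trace t0 t1
    have hkk := h.scalMap_mem hk
    have hββ := h.scalMap_mem hβ
    rw [e3, star_add, star_mul, star_star, X'.star_eq _ hkk, X'.star_eq _ hββ, add_mul, mul_add,
      ← h.central' _ hkk w, add_left_inj, ← h.central' _ hββ (star s), mul_assoc, ← mul_assoc w,
      ← h.central' _ hββ w, mul_assoc, hcomm, e1] at h2
    have h3 := mul_left_cancel₀ hn0 h2
    have h4 : (star s - s) * w = 0 := by rw [sub_mul, h3, sub_self]
    exact (mul_eq_zero.1 h4).resolve_left (sub_ne_zero.2 hs)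
  have hu0 : u = 0 := (mul_eq_zero.1 hw0).resolve_left (by simpa using ho.ne_zero)
  have h1 := h.vecMap_smul_add x d
  have h2 := h.vecMap_smul_add (T.ofVec X c) d
  change vecMap γ (d <• X.q c) + vecMap γ (c <• X.f c d) = vecMap γ d <• _ +
    vecMap γ c <• X'.f (vecMap γ c) (vecMap γ d) at h2
  rw [hw, hw0, hcd, op_zero, op_zero, zero_smul, zero_smul, h.vecMap_zero, add_zero, add_zero, e2,
    e3, right_smul_add, right_smul_mul, h.vecMap_add, h.vecMap_smul _ hβ, h.vecMap_smul _ hk,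
    right_smul_add, add_left_inj, right_smul_mul] at h2
  rw [← hudef, hu0, had, op_zero, op_zero, zero_smul, zero_smul, h.vecMap_zero, add_zero,
    add_zero] at h1
  rw [h1, ← right_smul_mul, ← right_smul_mul, e1] at h2
  have h3 := right_smul_cancel (mt h.vecMap_eq_zero.1 hd) h2
  exact hs (mul_right_cancel₀ hn0 h3).symm

/-- Pull `s` and `j'` back along `ψ` to `τ` and `i`. Since `τ` and `t` share trace and norm, an
element `g` conjugates `τ` to `t` and `i` to a skew `i₀` with `i₀² = -β`. Then `q(a i₀) + q(c)` is
`(t^σ + t) β` modulo `K₀`, so anisotropy gives `a i₀ + c = 0`, against `f(a, c) = 0`. -/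
theorem IsObstruction.false_of_ringEquiv (h : IsCentralJordanIso γ) {x : X.T} {j' : K'} {c : L}
    (ho : IsObstruction γ x j' c) (ψ : K ≃+* K') (hψ : ∀ k ∈ X.K₀, scalMap γ k = ψ k) :
    False := by
  obtain ⟨β, hβ, k, hk, e1, e2, -⟩ := ho.exists_scal_eq h
  have hs := h.star_scal_ne ho.star_ne
  have hj' := h.central'.star_of_skew hs ho.skew
  have hT := X.add_star_mem x.scal
  have hN := X.mul_star_mem x.scal
  have hT' := h.scalMap_trace x
  have hN' := h.scalMap_norm x
  rw [hψ _ hT] at hT'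
  rw [hψ _ hN] at hN'
  rw [hψ _ hβ] at e1
  have hx := ho.star_ne
  set t := x.scal with ht
  set s := (γ x).scal with hsdef
  set i := ψ.symm j' with hi
  set τ := ψ.symm s with hτ
  have hi0 : i ≠ 0 := by simpa [hi] using ho.ne_zero
  have hii : i * i = -β := by
    apply ψ.injective
    rw [map_mul, hi, RingEquiv.apply_symm_apply, map_neg, e1, hj', neg_mul, neg_neg]
  have hτi : τ * i = i * (t + star t - τ) := by
    apply ψ.injective
    rw [map_mul, map_mul, map_sub, hi, hτ, RingEquiv.apply_symm_apply, RingEquiv.apply_symm_apply,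
      hT', add_sub_cancel_left, ho.skew]
  have hττ : (t + star t - τ) * τ = t * star t := by
    apply ψ.injective
    rw [map_mul, map_sub, hτ, RingEquiv.apply_symm_apply, hT', hN', add_sub_cancel_left,
      h.central'.mul_star_comm]
  -- Explicit Skolem-Noether: every `t y - y (T - τ)` intertwines `t` and `τ`. As `ψ` need not
  -- respect the involutions, `T - τ` plays the conjugate of `τ`.
  obtain ⟨y, hy⟩ : ∃ y, t * y - y * (t + star t - τ) ≠ 0 := by
    by_contra hc
    push Not at hc
    have c1 := hc 1
    rw [mul_one, one_mul, sub_eq_zero] at c1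
    have c2 := hc i
    rw [← c1, sub_eq_zero] at c2
    rw [← c1, ← c2] at hτi
    have c3 := mul_right_cancel₀ hi0 hτi
    rw [c3, add_sub_cancel_left] at c1
    exact hx c1.symm
  set g := t * y - y * (t + star t - τ) with hg
  have htg : t * g = g * τ := by
    have d1 : t * g = t * (t * y) - t * y * (t + star t) + t * y * τ := by
      rw [hg]
      noncomm_ring
    have d2 : g * τ = t * y * τ - y * ((t + star t - τ) * τ) := by
      rw [hg]
      noncomm_ring
    rw [d1, d2, hττ, mul_assoc t y, ← h.central _ hT y, ← h.central _ hN y]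
    noncomm_ring
  have hgt : τ * g⁻¹ = g⁻¹ * t := by
    rw [eq_inv_mul_iff_mul_eq₀ hy, ← mul_assoc, ← htg, mul_inv_cancel_right₀ hy]
  set i₀ := g * i * g⁻¹ with hi₀
  have hi₀s : t * i₀ = i₀ * star t := by
    have d1 : t * i₀ = g * (τ * i) * g⁻¹ := by
      rw [hi₀, ← mul_assoc, ← mul_assoc, htg, mul_assoc g]
    have d2 : g * (i * (t + star t - τ)) * g⁻¹ =
        g * i * ((t + star t) * g⁻¹) - g * i * (τ * g⁻¹) := by noncomm_ring
    rw [d1, hτi, d2, hgt, h.central _ hT, ← mul_assoc, ← mul_assoc, ← hi₀, ← mul_sub,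
      add_sub_cancel_left]
  have hi₀i₀ : i₀ * i₀ = -β := by
    have d1 : i₀ * i₀ = g * (i * i) * g⁻¹ := by
      rw [hi₀]
      simp only [mul_assoc, inv_mul_cancel_left₀ hy]
    rw [d1, hii, mul_neg, ← h.central _ hβ, neg_mul, mul_inv_cancel_right₀ hy]
  have hi₀0 : i₀ ≠ 0 := mul_ne_zero (mul_ne_zero hy hi0) (inv_ne_zero hy)
  have hst := h.central.star_of_skew hx hi₀s
  have hv : x.vec <• i₀ + c = 0 := by
    rw [← X.q_mem_iff]
    have h1 := X.q_add (x.vec <• i₀) c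
    have h2 := (x.smul i₀).mem
    rw [X.f_smul_left, ho.f_eq_zero, mul_zero, add_zero, e2] at h1
    rw [T.smul_vec, T.smul_scal, mul_assoc, ← ht, hi₀s, ← mul_assoc, hst, neg_mul, hi₀i₀,
      neg_neg] at h2
    have h3 := add_mem (add_mem (add_mem h1 h2) hk) (h.mul_mem hT hβ)
    have d : β * star t = star t * β := h.central _ hβ _
    convert h3 using 1
    rw [d]
    noncomm_ring
  have h1 := congrArg (X.f x.vec) hv
  rw [X.f_add_right, X.f_smul_right, ho.f_eq_zero, X.f_zero_right, add_zero, x.f_self] at h1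
  exact hi₀0 ((mul_eq_zero.1 h1).resolve_left (sub_ne_zero.2 fun e => hx e.symm))

end IsCentralJordanIso

end PseudoQuadraticSpace

/-! ### From preserved skew lines to the isomorphism. -/

namespace PseudoQuadraticSpace

open scoped RightActions

variable {K L K' L' : Type*}
  [DivisionRing K] [StarRing K] [AddCommGroup L] [Module Kᵐᵒᵖ L]
  [DivisionRing K'] [StarRing K'] [AddCommGroup L'] [Module K'ᵐᵒᵖ L']
  {X' : PseudoQuadraticSpace K' L'} {X : PseudoQuadraticSpace K L}

/-- For `(a, t) ∈ T` with `t^σ ≠ t` and `0 ≠ j` with `t j = j t^σ`, the image of `a j` is not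
orthogonal to the image of `a`. -/
def PreservesSkewLines (γ : X.T ≃* X'.T) : Prop :=
  ∀ x : X.T, star x.scal ≠ x.scal → ∀ j ≠ 0, x.scal * j = j * star x.scal →
    X'.f (vecMap γ x.vec) (vecMap γ (x.vec <• j)) ≠ 0

namespace IsCentralJordanIso

variable {γ : X.T ≃* X'.T}

theorem preservesSkewLines_symm (h : IsCentralJordanIso γ)
    (hno : ∀ x j' c, ¬ IsObstruction γ x j' c) : PreservesSkewLines γ.symm := by
  intro y hy j' hj0 hj hf
  obtain ⟨x, rfl⟩ := γ.surjective y
  have hx := h.symm.star_scal_ne hy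
  rw [MulEquiv.symm_apply_apply] at hx
  rw [h.map_vec, h.symm_vecMap] at hf
  exact hno x j' _ ⟨hx, hj0, hj, h.vecMap_symm _, hf⟩

/-- If `γ⁻¹(γ(a) j')` is not orthogonal to `a`, it is of the form `a j`. -/
theorem exists_skew_preimage (h : IsCentralJordanIso γ) (hJ : PreservesSkewLines γ.symm)
    {x : X.T} (hx : star x.scal ≠ x.scal) {j' : K'} (hj0 : j' ≠ 0)
    (hj : (γ x).scal * j' = j' * star (γ x).scal) :
    ∃ j, x.scal * j = j * star x.scal ∧ vecMap γ (x.vec <• j) = vecMap γ x.vec <• j' ∧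
      vecMap γ ((x.vec <• j) <• x.scal) = vecMap γ (x.vec <• j) <• (γ x).scal := by
  have hs := h.star_scal_ne hx
  obtain ⟨j, e1, e2, e3⟩ := h.symm.exists_skew_of_f_ne_zero hs hj (hJ _ hs j' hj0 hj)
  rw [MulEquiv.symm_apply_apply, h.map_vec, h.symm_vecMap] at *
  have e4 : vecMap γ (x.vec <• j) = vecMap γ x.vec <• j' := by rw [← e2, h.vecMap_symm]
  refine ⟨j, e1, e4, ?_⟩
  rw [e4, ← h.vecMap_symm (_ <• (γ x).scal), e3, e2]

/-- If `s` has a nonzero skew `j'`, its preimage `a i` is available and `j ∈ i (K₀ + K₀ t)`, so `(a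
j)'` lies in `a' K'` and cannot be orthogonal to `a'`. If it has none and some `d ≠ 0` is orthogonal
to `a`, then `(a j)'` is an obstruction for `γ⁻¹` and `d'` is orthogonal to both its vectors. -/
theorem preservesSkewLines_of_symm (h : IsCentralJordanIso γ) (hJ : PreservesSkewLines γ.symm)
    (hcases : ∀ x : X.T, star x.scal ≠ x.scal →
      (∃ d ≠ 0, X.f x.vec d = 0) ∨ (∀ j, x.scal * j = j * star x.scal → j = 0) ∨
      ∃ j' ≠ 0, (γ x).scal * j' = j' * star (γ x).scal) : PreservesSkewLines γ := by
  intro x hx j hj0 hj hf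
  have hs := h.star_scal_ne hx
  have hb := h.smul_star_of_f_eq_zero hj hf
  have ha : x.vec ≠ 0 := by
    intro h0
    have h1 := x.f_self
    rw [h0, X.f_zero_left] at h1
    exact hx (sub_eq_zero.1 h1.symm).symm
  by_cases hex : ∃ j' ≠ 0, (γ x).scal * j' = j' * star (γ x).scal
  · obtain ⟨j', hj0', hj'⟩ := hex
    obtain ⟨i, e1, e2, e3⟩ := h.exists_skew_preimage hJ hx hj0' hj'
    have hi0 : i ≠ 0 := by
      rintro rfl
      rw [op_zero, zero_smul, h.vecMap_zero] at e2
      rcases smul_eq_zero.1 e2.symm with h2 | h2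
      · exact hj0' ((op_eq_zero_iff _).1 h2)
      · exact ha (h.vecMap_eq_zero.1 h2)
    obtain ⟨k, hk, l, hl, e⟩ := h.central.exists_lin_of_commute h.proper.star_ne hx
      (h.central.skew_div hi0 e1 hj)
    have e4 : x.vec <• j = (x.vec <• i) <• k + ((x.vec <• i) <• x.scal) <• l := by
      have : j = i * (i⁻¹ * j) := by rw [mul_inv_cancel_left₀ hi0]
      rw [this, e, right_smul_mul, right_smul_add, h.central l hl, right_smul_mul]
    have e5 : vecMap γ (x.vec <• j) =
        vecMap γ x.vec <• (j' * scalMap γ k + j' * ((γ x).scal * scalMap γ l)) := by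
      rw [e4, h.vecMap_add, h.vecMap_smul _ hk, h.vecMap_smul _ hl, e3, e2, right_smul_add,
        right_smul_mul _ j', right_smul_mul _ j', right_smul_mul _ (γ x).scal]
    rw [e5, X'.f_smul_right, ← h.map_vec, (γ x).f_self] at hf
    have hz := (mul_eq_zero.1 hf).resolve_left (sub_ne_zero.2 fun e => hs e.symm)
    rw [hz, op_zero, zero_smul, h.vecMap_eq_zero] at e5
    rcases smul_eq_zero.1 e5 with h2 | h2
    · exact hj0 ((op_eq_zero_iff _).1 h2)
    · exact ha h2
  · rcases hcases x hx with ⟨d, hd0, hd⟩ | h0 | hex'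
    · push Not at hex
      have hzero : ∀ w, (γ x).scal * w = w * star (γ x).scal → w = 0 := by
        intro w hw
        by_contra hw0
        exact hex w hw0 hw
      have f1 : X'.f (vecMap γ x.vec) (vecMap γ d) = 0 :=
        hzero _ (h.skew_f hx (by rw [hd, mul_zero, zero_mul]))
      have f2 : X'.f (vecMap γ (x.vec <• j)) (vecMap γ d) = 0 := by
        apply hzero
        apply h.central'.skew_of_trace
        · rw [← h.scalMap_trace_f, X.f_smul_left, hd, mul_zero, star_zero, add_zero,
            h.scalMap_zero]
        · rw [← X'.f_smul_left, ← hb, ← h.scalMap_trace_f, X.f_smul_left, X.f_smul_left, hd,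
            mul_zero, mul_zero, star_zero, add_zero, h.scalMap_zero]
      have ho : IsObstruction γ.symm (γ x) j (vecMap γ (x.vec <• j)) := by
        refine ⟨hs, hj0, ?_, ?_, ?_⟩
        · rwa [MulEquiv.symm_apply_apply]
        · rw [h.map_vec, h.symm_vecMap, h.symm_vecMap]
        · rwa [h.map_vec]
      have := ho.eq_zero_of_orthogonal h.symm (d := vecMap γ d) (by rwa [h.map_vec]) f2
      exact hd0 (h.vecMap_eq_zero.1 this)
    · exact hj0 (h0 j hj)
    · exact hex hex'

/-- The value `u = f'(a', b')` is skew and trace-orthogonal to every skew `j'`. Testing `j' = u`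
gives characteristic 2 if `u ≠ 0`, and `j' = u s` then gives `s = s^σ`. -/
theorem f_eq_zero_of_f_eq_zero (h : IsCentralJordanIso γ) (hJ : PreservesSkewLines γ.symm)
    {x : X.T} (hx : star x.scal ≠ x.scal) {b : L} (hb : X.f x.vec b = 0) :
    X'.f (vecMap γ x.vec) (vecMap γ b) = 0 := by
  have hs := h.star_scal_ne hx
  by_contra hc
  have hu := h.skew_f hx (b := b) (by rw [hb, mul_zero, zero_mul])
  set u := X'.f (vecMap γ x.vec) (vecMap γ b) with hudef
  set s := (γ x).scal with hsdef
  have hs0 : s ≠ 0 := fun h0 => hs (by rw [h0, star_zero])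
  have key : ∀ j' ≠ 0, s * j' = j' * star s → star j' * u + star (star j' * u) = 0 := by
    intro j' hj0 hj
    obtain ⟨j, -, e2, -⟩ := h.exists_skew_preimage hJ hx hj0 hj
    rw [hudef, ← X'.f_smul_left, ← e2, ← h.scalMap_trace_f, X.f_smul_left, hb, mul_zero, star_zero,
      add_zero, h.scalMap_zero]
  have hn := X'.star_mul_mem u
  have hn0 : star u * u ≠ 0 := mul_ne_zero (by simpa using hc) hc
  have k1 := key u hc hu
  have k2 := key (u * s) (mul_ne_zero hc hs0) (by
    rw [← mul_assoc, hu, mul_assoc, mul_assoc, h.central'.mul_star_comm])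
  rw [X'.star_eq _ hn] at k1
  rw [star_mul, mul_assoc, star_mul, star_star, X'.star_eq _ hn, ← h.central' _ hn, ← mul_add] at k2
  have k3 := (mul_eq_zero.1 k2).resolve_left hn0
  have k4 : (1 + 1 : K') = 0 := by
    rw [← mul_one (star u * u), ← mul_add] at k1
    exact (mul_eq_zero.1 k1).resolve_left hn0
  apply hs
  have k5 : s + s = 0 := by rw [← mul_one s, ← mul_add, k4, mul_zero]
  rw [← k5] at k3
  exact add_right_cancel k3

theorem vecMap_smul_scal_of_preserves (h : IsCentralJordanIso γ) (hJ : PreservesSkewLines γ)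
    (hJ' : PreservesSkewLines γ.symm) {x : X.T} (hx : star x.scal ≠ x.scal) (b : L) :
    vecMap γ (b <• x.scal) = vecMap γ b <• (γ x).scal := by
  have hd : x.scal - star x.scal ≠ 0 := sub_ne_zero.2 fun e => hx e.symm
  obtain ⟨e, w, hew, he, hw⟩ := h.central.exists_add_skew hx
    ((x.scal - star x.scal)⁻¹ * X.f x.vec b)
  obtain ⟨k, hk, l, hl, rfl⟩ := h.central.exists_lin_of_commute h.proper.star_ne hx he
  set b₀ := b - x.vec <• ((x.scal - star x.scal)⁻¹ * X.f x.vec b) with hb₀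
  have hb : b = b₀ + (x.vec <• k + (x.vec <• x.scal) <• l + x.vec <• w) := by
    rw [← right_smul_mul, ← h.central l hl, ← right_smul_add, ← right_smul_add, ← hew, hb₀,
      sub_add_cancel]
  have hf : X.f x.vec b₀ = 0 := by
    rw [hb₀, sub_eq_add_neg, X.f_add_right, X.f_neg_right, X.f_smul_right, x.f_self,
      mul_inv_cancel_left₀ hd, add_neg_cancel]
  have c0 : vecMap γ (b₀ <• x.scal) = vecMap γ b₀ <• (γ x).scal := by
    have h1 := h.vecMap_smul_add x b₀
    rwa [hf, h.f_eq_zero_of_f_eq_zero hJ' hx hf, op_zero, op_zero, zero_smul, zero_smul,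
      h.vecMap_zero, add_zero, add_zero] at h1
  have cw : vecMap γ ((x.vec <• w) <• x.scal) = vecMap γ (x.vec <• w) <• (γ x).scal := by
    by_cases hw0 : w = 0
    · rw [hw0, op_zero, zero_smul, smul_zero, h.vecMap_zero, smul_zero]
    · obtain ⟨-, -, -, e3⟩ := h.exists_skew_of_f_ne_zero hx hw (hJ x hx w hw0 hw)
      exact e3
  have swap : ∀ (v : L) (k : K), k ∈ X.K₀ → vecMap γ (v <• x.scal) = vecMap γ v <• (γ x).scal →
      vecMap γ ((v <• k) <• x.scal) = vecMap γ (v <• k) <• (γ x).scal := by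
    intro v k hk hv
    rw [← right_smul_mul, h.central k hk, right_smul_mul, h.vecMap_smul _ hk, hv,
      h.vecMap_smul _ hk, ← right_smul_mul, ← right_smul_mul, h.central' _ (h.scalMap_mem hk)]
  have ct : vecMap γ ((x.vec <• x.scal) <• x.scal) =
      vecMap γ (x.vec <• x.scal) <• (γ x).scal := by
    have e1 : x.scal * x.scal = x.scal * (x.scal + star x.scal) - x.scal * star x.scal := by
      noncomm_ring
    have e2 : (γ x).scal * (γ x).scal =
        (γ x).scal * ((γ x).scal + star (γ x).scal) - (γ x).scal * star (γ x).scal := by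
      noncomm_ring
    rw [h.vecMap_smul_scal, ← right_smul_mul, ← right_smul_mul, e1, e2, right_smul_sub,
      right_smul_sub, h.vecMap_sub, right_smul_mul, h.vecMap_smul _ (X.add_star_mem _),
      h.vecMap_smul _ (X.mul_star_mem _), h.vecMap_smul_scal, h.scalMap_trace, h.scalMap_norm,
      ← right_smul_mul]
  rw [hb]
  simp only [smul_add, h.vecMap_add]
  rw [c0, cw, swap _ _ hk (h.vecMap_smul_scal x), swap _ _ hl ct]

theorem multipliers_eq_top (h : IsCentralJordanIso γ) (hJ : PreservesSkewLines γ)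
    (hJ' : PreservesSkewLines γ.symm) (y : K) :
    ∃ z : K', ∀ a, vecMap γ (a <• y) = vecMap γ a <• z := by
  set P := h.multipliers with hP
  have hK₀ : ∀ {k : K}, k ∈ X.K₀ → k ∈ P := fun hk => h.mem_multipliers hk
  have hgood : ∀ x : X.T, star x.scal ≠ x.scal → x.scal ∈ P := fun x hx =>
    ⟨_, h.vecMap_smul_scal_of_preserves hJ hJ' hx⟩
  obtain ⟨x, hx⟩ := exists_star_scal_ne h.proper
  have ht := hgood x hx
  have hst : star x.scal ∈ P := by
    have := sub_mem (hK₀ (X.add_star_mem x.scal)) ht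
    rwa [add_sub_cancel_left] at this
  have hd : x.scal - star x.scal ≠ 0 := sub_ne_zero.2 fun e => hx e.symm
  have hdi : (x.scal - star x.scal)⁻¹ ∈ P := by
    have hδ : (x.scal - star x.scal) * (x.scal - star x.scal) ∈ X.K₀ := by
      have := X.K₀.neg_mem (X.mul_star_mem (x.scal - star x.scal))
      rwa [star_sub, star_star, ← mul_neg, neg_sub] at this
    have := P.mul_mem (sub_mem ht hst) (hK₀ (X.inv_mem hδ))
    rwa [mul_inv_rev, mul_inv_cancel_left₀ hd] at this
  -- The scalar `(1 + j)^σ t (1 + j) = t + (t - t^σ) j - t^σ j²` is again a multiplier, and `j` can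
  -- be solved for.
  have hskew : ∀ j, x.scal * j = j * star x.scal → j ∈ P := by
    intro j hj
    have hj1 : 1 + j ≠ 0 := by
      intro h0
      rw [eq_neg_of_add_eq_zero_right h0, mul_neg, neg_mul, mul_one, one_mul, neg_inj] at hj
      exact hx hj.symm
    have hsj := h.central.star_of_skew hx hj
    have hm := hgood (x.smul (1 + j)) (by
      rw [T.smul_scal, star_mul, star_mul, star_star, mul_assoc (star (1 + j))]
      intro e
      exact hx (mul_right_cancel₀ hj1 (mul_left_cancel₀ (star_ne_zero.2 hj1) e)))
    have hn : j * j ∈ X.K₀ := by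
      have := neg_mem (X.mul_star_mem j)
      rwa [hsj, mul_neg, neg_neg] at this
    have e : star (1 + j) * x.scal * (1 + j) =
        x.scal + (x.scal - star x.scal) * j - star x.scal * (j * j) := by
      have e1 : (1 + -j) * x.scal * (1 + j) =
          x.scal + x.scal * j - j * x.scal - j * x.scal * j := by
        noncomm_ring
      rw [star_add, star_one, hsj, e1, h.central.skew_mul hj]
      noncomm_ring
    rw [T.smul_scal, e] at hm
    have h1 := sub_mem (add_mem hm (P.mul_mem hst (hK₀ hn))) ht
    rw [sub_add_cancel, add_sub_cancel_left] at h1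
    have h2 := P.mul_mem hdi h1
    rwa [inv_mul_cancel_left₀ hd] at h2
  change y ∈ P
  obtain ⟨e, w, rfl, he, hw⟩ := h.central.exists_add_skew hx y
  obtain ⟨k, hk, l, hl, rfl⟩ := h.central.exists_lin_of_commute h.proper.star_ne hx he
  exact add_mem (add_mem (hK₀ hk) (P.mul_mem (hK₀ hl) ht)) (hskew w hw)

theorem exists_iso_of_preserves (h : IsCentralJordanIso γ) (hJ : PreservesSkewLines γ)
    (hJ' : PreservesSkewLines γ.symm) : ∃ Φ : Iso X X', Φ.Induces γ := by
  obtain ⟨ϕ, hϕ⟩ := h.exists_ringHom (h.multipliers_eq_top hJ hJ')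
  obtain ⟨a, ha⟩ := @exists_ne L h.proper.nontrivial 0
  have hsurj : Function.Surjective ϕ := by
    intro y
    obtain ⟨x, hx⟩ := h.symm.multipliers_eq_top hJ' hJ y
    refine ⟨x, right_smul_cancel (mt h.vecMap_eq_zero.1 ha) ?_⟩
    have h1 := hx (vecMap γ a)
    rw [h.symm_vecMap] at h1
    rw [← hϕ, ← h1, h.vecMap_symm]
  have hK₀ : ∀ {k : K}, k ∈ X.K₀ → ϕ k = scalMap γ k := fun hk => h.eq_scalMap hϕ hk
  refine h.exists_iso ϕ hsurj hϕ ?_ ?_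
  · intro x
    have hT := X.add_star_mem x
    have hN := X.star_mul_mem x
    have hTm : ϕ (x + star x) ∈ X'.K₀ := by rw [hK₀ hT]; exact h.scalMap_mem hT
    have hNm : ϕ (star x * x) ∈ X'.K₀ := by rw [hK₀ hN]; exact h.scalMap_mem hN
    have hT' := X'.add_star_mem (ϕ x)
    have hN' := X'.star_mul_mem (ϕ x)
    -- Both `(ϕ(T), ϕ(N))` and the trace and norm of `ϕ(x)` give a quadratic equation for `ϕ(x)`.
    -- Either the traces agree, or `ϕ(x) ∈ K₀'` and both involutions fix the elements.
    have e : (ϕ (x + star x) - (ϕ x + star (ϕ x))) * ϕ x =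
        ϕ (star x * x) - star (ϕ x) * ϕ x := by
      rw [map_add, map_mul]
      noncomm_ring
    by_cases h0 : ϕ (x + star x) - (ϕ x + star (ϕ x)) = 0
    · rw [map_add, add_sub_add_left_eq_sub, sub_eq_zero] at h0
      exact h0
    · have h1 : ϕ x ∈ X'.K₀ := by
        have e2 : ϕ x = (ϕ (x + star x) - (ϕ x + star (ϕ x)))⁻¹ *
            (ϕ (star x * x) - star (ϕ x) * ϕ x) := by rw [← e, inv_mul_cancel_left₀ h0]
        rw [e2]
        exact h.symm.mul_mem (X'.inv_mem (sub_mem hTm hT')) (sub_mem hNm hN')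
      have h2 : x ∈ X.K₀ := by
        have h3 := h.symm.scalMap_mem h1
        have h4 : ϕ (scalMap γ.symm (ϕ x)) = ϕ x := by rw [hK₀ h3, h.scalMap_symm h1]
        rwa [ϕ.injective h4] at h3
      rw [X.star_eq x h2, X'.star_eq _ h1]
  · intro x
    by_cases h0 : x.vec = 0
    · obtain ⟨hk, e⟩ := T.eq_ofK₀ x h0
      obtain ⟨hk', e'⟩ := h.map_ofK₀ hk
      rw [hK₀ hk, e, e']
      rfl
    · have h1 := h.vecMap_smul_scal x
      rw [hϕ] at h1
      exact (right_smul_cancel (mt h.vecMap_eq_zero.1 h0) h1).symm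

end IsCentralJordanIso

end PseudoQuadraticSpace

/-! ### The field with four elements. -/

namespace InvolutorySet

variable {K : Type*} [DivisionRing K] [StarRing K] {S : InvolutorySet K}

theorem IsQuadraticOfTypeIII.mul_comm (hS : S.IsQuadraticOfTypeIII) (x y : K) :
    x * y = y * x := hS.1 x y

theorem isCentral_of_isQuadratic (hS : S.IsQuadraticOfTypeIII ∨ S.IsQuadraticOfTypeIV) :
    S.IsCentral := by
  intro k hk x
  rcases hS with hS | hS
  · exact hS.mul_comm k x
  · have h : k ∈ Set.center K := hS.1 ▸ hk
    exact (Set.mem_center_iff.1 h).comm x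

theorem one_add_one_of_two (h2 : ∀ k ∈ S.K₀, k = 0 ∨ k = 1) : (1 + 1 : K) = 0 := by
  rcases h2 _ (S.K₀.add_mem S.one_mem S.one_mem) with h | h
  · exact h
  · exact absurd (add_eq_left.1 h) one_ne_zero

theorem mem_of_star_eq_of_two (h2 : ∀ k ∈ S.K₀, k = 0 ∨ k = 1) {x : K}
    (hx : star x = x) : x ∈ S.K₀ := by
  have h11 := one_add_one_of_two h2
  have h := S.star_mul_mem x
  rw [hx] at h
  rcases h2 _ h with h0 | h1
  · rw [mul_self_eq_zero.1 h0]
    exact S.K₀.zero_mem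
  · have e : (x + 1) * (x + 1) = x * x + 1 + x * (1 + 1) := by noncomm_ring
    rw [h1, h11, mul_zero, add_zero, mul_self_eq_zero] at e
    rw [eq_neg_of_add_eq_zero_left e]
    exact S.K₀.neg_mem S.one_mem

theorem trace_eq_one_of_two (h2 : ∀ k ∈ S.K₀, k = 0 ∨ k = 1) {x : K}
    (hx : star x ≠ x) : x + star x = 1 := by
  refine (h2 _ (S.add_star_mem x)).resolve_left fun h0 => hx ?_
  have e : x + x = 0 := by rw [← mul_one x, ← mul_add, one_add_one_of_two h2, mul_zero]
  rw [← e] at h0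
  exact add_left_cancel h0

/-- If `K₀` has only two elements, then `K` is the field with four elements. -/
theorem nonempty_ringEquiv_of_two (h2 : ∀ k ∈ S.K₀, k = 0 ∨ k = 1)
    (hσ : ∃ x : K, star x ≠ x) :
    Nonempty (K ≃+* GaloisField 2 2) := by
  have h11 := one_add_one_of_two h2
  obtain ⟨w, hw⟩ := hσ
  have hK : ∀ x : K, star x = x → x = 0 ∨ x = 1 := fun x hx => h2 x (mem_of_star_eq_of_two h2 hx)
  have hw1 : star (w + 1) ≠ w + 1 := by
    rw [star_add, star_one]
    exact fun h => hw (add_right_cancel h)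
  classical
  have hcover : ∀ x : K, x ∈ ({0, 1, w, w + 1} : Finset K) := by
    intro x
    simp only [Finset.mem_insert, Finset.mem_singleton]
    by_cases hx : star x = x
    · rcases hK x hx with h | h <;> simp [h]
    · have h3 : star (x - w) = x - w := by
        have h4 := trace_eq_one_of_two h2 hx
        rw [← trace_eq_one_of_two h2 hw, ← sub_eq_zero] at h4
        have h5 : star (x - w) = -(x - w) := by
          rw [star_sub, eq_neg_iff_add_eq_zero, ← h4]
          abel
        rw [h5, neg_eq_iff_add_eq_zero, ← mul_one (x - w), ← mul_add, h11, mul_zero]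
      rcases hK _ h3 with h | h
      · simp [sub_eq_zero.1 h]
      · simp [sub_eq_iff_eq_add'.1 h]
  have hcard : ({0, 1, w, w + 1} : Finset K).card = 4 := by
    have n0 : w ≠ 0 := fun h => hw (by simp [h])
    have n1 : w ≠ 1 := fun h => hw (by simp [h])
    have n2 : w + 1 ≠ 0 := fun h => hw1 (by simp [h])
    rw [Finset.card_insert_of_notMem, Finset.card_insert_of_notMem, Finset.card_insert_of_notMem,
      Finset.card_singleton] <;> simp [n0, n0.symm, n1.symm, n2.symm]
  let _ : Fintype K := ⟨_, hcover⟩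
  have : Finite K := inferInstance
  let _ : Field K := littleWedderburn K
  let _ : Fintype (GaloisField 2 2) := Fintype.ofFinite _
  refine ⟨FiniteField.ringEquivOfCardEq ?_⟩
  rw [← Nat.card_eq_fintype_card (α := GaloisField 2 2), GaloisField.card 2 2 two_ne_zero]
  exact hcard

end InvolutorySet

/-! ### Dimension arguments and the conclusion. -/

namespace PseudoQuadraticSpace

open scoped RightActions

variable {K L K' L' : Type*}
  [DivisionRing K] [StarRing K] [AddCommGroup L] [Module Kᵐᵒᵖ L]
  [DivisionRing K'] [StarRing K'] [AddCommGroup L'] [Module K'ᵐᵒᵖ L']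
  {X' : PseudoQuadraticSpace K' L'} {X : PseudoQuadraticSpace K L}

theorem exists_ne_add_of_rank {K L : Type*} [DivisionRing K] [AddCommGroup L] [Module Kᵐᵒᵖ L]
    (hr : 3 ≤ Module.rank Kᵐᵒᵖ L) (a c : L) :
    ∃ d : L, ∀ s t : K, d ≠ a <• s + c <• t := by
  classical
  by_contra hc
  push Not at hc
  have htop : Submodule.span Kᵐᵒᵖ (({a, c} : Finset L) : Set L) = ⊤ := by
    rw [eq_top_iff]
    intro d _
    obtain ⟨s, t, rfl⟩ := hc d
    exact add_mem (Submodule.smul_mem _ _ (Submodule.subset_span (by simp)))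
      (Submodule.smul_mem _ _ (Submodule.subset_span (by simp)))
  have h1 := rank_span_finset_le (R := Kᵐᵒᵖ) ({a, c} : Finset L)
  rw [htop, rank_top] at h1
  have h2 : (({a, c} : Finset L).card : Cardinal) ≤ (2 : ℕ) := by
    exact_mod_cast Finset.card_le_two
  have h3 := (hr.trans h1).trans h2
  norm_cast at h3

theorem exists_orthogonal_of_rank (hr : 3 ≤ Module.rank Kᵐᵒᵖ L) {a c : L} (ha : X.f a a ≠ 0)
    (hc : X.f c c ≠ 0) (hac : X.f a c = 0) : ∃ d ≠ 0, X.f a d = 0 ∧ X.f c d = 0 := by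
  obtain ⟨d, hd⟩ := exists_ne_add_of_rank hr a c
  have hca : X.f c a = 0 := by rw [← neg_eq_zero, ← X.star_f, hac, star_zero]
  refine ⟨d - (a <• ((X.f a a)⁻¹ * X.f a d) + c <• ((X.f c c)⁻¹ * X.f c d)),
    sub_ne_zero.2 (hd _ _), ?_, ?_⟩
  · rw [sub_eq_add_neg, X.f_add_right, X.f_neg_right, X.f_add_right, X.f_smul_right,
      X.f_smul_right, hac, mul_inv_cancel_left₀ ha, zero_mul, add_zero, add_neg_cancel]
  · rw [sub_eq_add_neg, X.f_add_right, X.f_neg_right, X.f_add_right, X.f_smul_right,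
      X.f_smul_right, hca, mul_inv_cancel_left₀ hc, zero_mul, zero_add, add_neg_cancel]

theorem exists_orthogonal_of_rank' (hr : 3 ≤ Module.rank Kᵐᵒᵖ L) {a : L} (ha : X.f a a ≠ 0) :
    ∃ d ≠ 0, X.f a d = 0 := by
  obtain ⟨d, hd⟩ := exists_ne_add_of_rank hr a 0
  refine ⟨d - a <• ((X.f a a)⁻¹ * X.f a d), sub_ne_zero.2 ?_, ?_⟩
  · simpa using hd ((X.f a a)⁻¹ * X.f a d) 0
  · rw [sub_eq_add_neg, X.f_add_right, X.f_neg_right, X.f_smul_right, mul_inv_cancel_left₀ ha,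
      add_neg_cancel]

theorem eq_zero_of_rank_le_one (hr : Module.rank Kᵐᵒᵖ L ≤ 1) {a c : L} (ha : X.f a a ≠ 0)
    (hac : X.f a c = 0) : c = 0 := by
  obtain ⟨v, hv⟩ := rank_le_one_iff.1 hr
  obtain ⟨r, rfl⟩ := hv a
  obtain ⟨r', rfl⟩ := hv c
  have hr0 : r ≠ 0 := by
    rintro rfl
    rw [zero_smul, X.f_zero_left] at ha
    exact ha rfl
  have e : r' • v = (r • v) <• unop (r' * r⁻¹) := by
    rw [op_unop, smul_smul, inv_mul_cancel_right₀ hr0]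
  rw [e, X.f_smul_right] at hac
  rw [e, ← op_unop (op _), unop_op, (mul_eq_zero.1 hac).resolve_left ha, op_zero, zero_smul]

/-- If `K₀` has only two elements, then `dim L ≤ 1`. -/
theorem not_three_le_rank_of_two (hX : X.IsProper) (h2 : ∀ k ∈ X.K₀, k = 0 ∨ k = 1) :
    ¬ 3 ≤ Module.rank Kᵐᵒᵖ L := by
  intro hr
  have h11 := InvolutorySet.one_add_one_of_two h2
  -- Here `f(a,a)` is the trace of `q(a)`. Two nonzero orthogonal vectors would then have an
  -- isotropic sum, as `1 + 1 = 0`.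
  have hf : ∀ a, a ≠ 0 → X.f a a = 1 := by
    intro a ha
    have h1 : star (X.q a) ≠ X.q a := fun h1 =>
      ha ((X.q_mem_iff a).1 (InvolutorySet.mem_of_star_eq_of_two h2 h1))
    have h3 := InvolutorySet.trace_eq_one_of_two h2 h1
    rw [X.f_self, ← h3, sub_eq_add_neg, add_right_inj, neg_eq_iff_add_eq_zero, ← mul_one (star _),
      ← mul_add, h11, mul_zero]
  obtain ⟨a, ha⟩ := @exists_ne L hX.nontrivial 0
  obtain ⟨d, hd, had⟩ := exists_orthogonal_of_rank' (X := X) hr (a := a) (by simp [hf a ha])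
  have hda : X.f d a = 0 := by rw [← neg_eq_zero, ← X.star_f, had, star_zero]
  have hf' : X.f (a + d) (a + d) = 0 := by
    rw [X.f_add_left, X.f_add_right, X.f_add_right, had, hda, hf a ha, hf d hd, add_zero, zero_add,
      h11]
  have hs : a + d = 0 := by
    by_contra h0
    rw [hf _ h0] at hf'
    exact one_ne_zero hf'
  have h3 := congrArg (X.f a) hs
  rw [X.f_add_right, had, hf a ha, add_zero, X.f_zero_right] at h3
  exact one_ne_zero h3

theorem f_self_ne_zero {x : X.T} (hx : star x.scal ≠ x.scal) : X.f x.vec x.vec ≠ 0 := by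
  rw [x.f_self]
  exact sub_ne_zero.2 fun e => hx e.symm

namespace IsCentralJordanIso

variable {γ : X.T ≃* X'.T}

theorem exists_iso_of_three_le_rank (h : IsCentralJordanIso γ)
    (hr : 3 ≤ Module.rank Kᵐᵒᵖ L) : ∃ Φ : Iso X X', Φ.Induces γ := by
  have hJ' : PreservesSkewLines γ.symm := h.preservesSkewLines_symm fun x j' c ho => by
    obtain ⟨d, hd0, hd1, hd2⟩ := exists_orthogonal_of_rank hr (f_self_ne_zero ho.star_ne)
      (ho.f_self_ne_zero h) ho.f_eq_zero
    exact hd0 (ho.eq_zero_of_orthogonal h hd1 hd2)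
  exact h.exists_iso_of_preserves (h.preservesSkewLines_of_symm hJ' fun x hx =>
    Or.inl (exists_orthogonal_of_rank' hr (f_self_ne_zero hx))) hJ'

theorem skew_eq_zero_of_comm {K : Type*} [DivisionRing K] [StarRing K]
    (hK : ∀ x y : K, x * y = y * x) {t j : K} (ht : star t ≠ t) (hj : t * j = j * star t) :
    j = 0 := by
  rw [hK t, ← sub_eq_zero, ← mul_sub] at hj
  exact (mul_eq_zero.1 hj).resolve_right (sub_ne_zero.2 fun e => ht e.symm)

/-- Without skew elements, `K = K₀ + K₀ t` would be commutative. -/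
theorem exists_skew_ne_zero {S : InvolutorySet K} (hZ : S.IsCentral) (hσ : ∃ x : K, star x ≠ x)
    (hK : ¬ ∀ x y : K, x * y = y * x) {t : K} (ht : star t ≠ t) :
    ∃ j ≠ 0, t * j = j * star t := by
  by_contra hc
  push Not at hc
  have hlin : ∀ x, ∃ k ∈ S.K₀, ∃ l ∈ S.K₀, x = k + l * t := by
    intro x
    obtain ⟨e, w, rfl, he, hw⟩ := hZ.exists_add_skew ht x
    have hw0 : w = 0 := by
      by_contra h0
      exact hc w h0 hw
    rw [hw0, add_zero]
    exact hZ.exists_lin_of_commute hσ ht he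
  apply hK
  intro x y
  obtain ⟨k, hk, l, hl, rfl⟩ := hlin x
  have hyt : t * y = y * t := by
    obtain ⟨k', hk', l', hl', rfl⟩ := hlin y
    rw [mul_add, add_mul, ← hZ k' hk', ← mul_assoc, ← hZ l' hl']
  rw [add_mul, mul_add, hZ k hk, mul_assoc, hyt, ← mul_assoc, hZ l hl, mul_assoc]

/-- The only role of `ψ` here is that `K` and `K'` are both commutative, with no nonzero skew
elements, or both non-commutative, with skew elements on both sides. -/
theorem exists_iso_of_ringEquiv (h : IsCentralJordanIso γ) (ψ : K ≃+* K')
    (hno : (¬ ∀ x y : K, x * y = y * x) → ∀ x j' c, ¬ IsObstruction γ x j' c) :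
    ∃ Φ : Iso X X', Φ.Induces γ := by
  by_cases hK : ∀ x y : K, x * y = y * x
  · have hK' : ∀ x y : K', x * y = y * x := by
      intro x y
      apply ψ.symm.injective
      rw [map_mul, map_mul, hK]
    have hJ' : PreservesSkewLines γ.symm := h.preservesSkewLines_symm fun x j' c ho =>
      ho.ne_zero (skew_eq_zero_of_comm hK' (h.star_scal_ne ho.star_ne) ho.skew)
    exact h.exists_iso_of_preserves (h.preservesSkewLines_of_symm hJ' fun x hx =>
      Or.inr (Or.inl fun j hj => skew_eq_zero_of_comm hK hx hj)) hJ'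
  · have hK' : ¬ ∀ x y : K', x * y = y * x := by
      intro hK'
      apply hK
      intro x y
      apply ψ.injective
      rw [map_mul, map_mul, hK']
    have hJ' := h.preservesSkewLines_symm (hno hK)
    exact h.exists_iso_of_preserves (h.preservesSkewLines_of_symm hJ' fun x hx =>
      Or.inr (Or.inr (exists_skew_ne_zero h.central' h.proper'.star_ne hK'
        (h.star_scal_ne hx)))) hJ'

end IsCentralJordanIso

/-- If `K₀` is central, then so is `K₀'`. -/
theorem IsProperJordanIso.isCentral {γ : X.T ≃* X'.T} (h : IsProperJordanIso γ)
    (hZ : X.toInvolutorySet.IsCentral) : X'.toInvolutorySet.IsCentral := by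
  -- If `K₀'` generated `K'`, the proper case applied to `γ⁻¹` would carry two non-commuting
  -- elements of `K₀'` into the central `K₀`.
  apply InvolutorySet.isCentral_of_closure_ne_top
  intro hgen
  have hS : X'.toInvolutorySet.IsProperInvolutorySet := ⟨h.proper'.star_ne, hgen⟩
  obtain ⟨Φ, -⟩ := h.symm.exists_iso_of_isProperInvolutorySet hS
  obtain ⟨k, hk, l, -, hne⟩ := hS.not_commute
  apply hne
  apply Φ.scal.injective
  rw [map_mul, map_mul]
  have hm : Φ.scal k ∈ (X.K₀ : Set K) := by
    rw [← Φ.map_K₀]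
    exact ⟨k, hk, rfl⟩
  exact hZ _ hm _

end PseudoQuadraticSpace

theorem mainTheorem6
    {K L K' L' : Type*}
    [DivisionRing K] [StarRing K] [AddCommGroup L] [Module Kᵐᵒᵖ L]
    [DivisionRing K'] [StarRing K'] [AddCommGroup L'] [Module K'ᵐᵒᵖ L']
    (X : PseudoQuadraticSpace K L) (X' : PseudoQuadraticSpace K' L')
    (hX : X.IsProper) (hX' : X'.IsProper)
    (γ : X.T ≃* X'.T) (hγ : PseudoQuadraticSpace.IsJordanIso γ)
    (h : X.toInvolutorySet.IsProperInvolutorySet ∨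
      ((X.toInvolutorySet.IsQuadraticOfTypeIII ∨ X.toInvolutorySet.IsQuadraticOfTypeIV) ∧
        3 ≤ Module.rank Kᵐᵒᵖ L) ∨
      ((X.toInvolutorySet.IsQuadraticOfTypeIII ∨ X.toInvolutorySet.IsQuadraticOfTypeIV) ∧
        Module.rank Kᵐᵒᵖ L ≤ 2 ∧
        (∃ ψ : K ≃+* K',
          X.toInvolutorySet.IsQuadraticOfTypeIV → Module.rank Kᵐᵒᵖ L = 2 →
            ∀ t : X.K₀, (γ (.ofK₀ t)).scal = ψ t) ∧
        IsEmpty (K ≃+* GaloisField 2 2))) :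
    ∃ Φ : PseudoQuadraticSpace.Iso X X', Φ.Induces γ := by
  have hp : PseudoQuadraticSpace.IsProperJordanIso γ := ⟨hX, hX', hγ⟩
  have central : (X.toInvolutorySet.IsQuadraticOfTypeIII ∨
      X.toInvolutorySet.IsQuadraticOfTypeIV) → ¬ (∀ k ∈ X.K₀, k = 0 ∨ k = 1) →
      PseudoQuadraticSpace.IsCentralJordanIso γ := by
    intro hq h2
    have hZ := InvolutorySet.isCentral_of_isQuadratic hq
    push Not at h2
    exact ⟨hp, hZ, hp.isCentral hZ, h2⟩
  rcases h with hS | ⟨hq, hr⟩ | ⟨hq, hr, ⟨ψ, hψ⟩, hF⟩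
  · exact hp.exists_iso_of_isProperInvolutorySet hS
  · have hc := central hq fun h2 => PseudoQuadraticSpace.not_three_le_rank_of_two hX h2 hr
    exact hc.exists_iso_of_three_le_rank hr
  · have hc := central hq fun h2 =>
      (InvolutorySet.nonempty_ringEquiv_of_two h2 hX.star_ne).elim hF.elim
    refine hc.exists_iso_of_ringEquiv ψ fun hK x j' c ho => ?_
    have hIV := hq.resolve_left fun hIII => hK hIII.mul_comm
    -- In dimension at most 1 the vector `c`, being orthogonal to `a`, vanishes. Only dimension 2
    -- needs `ψ` to agree with `γ` on the centers.
    rcases hr.lt_or_eq with hlt | heq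
    · have hc0 := PseudoQuadraticSpace.eq_zero_of_rank_le_one (Order.lt_succ_iff.1 (by
        have : Order.succ (1 : Cardinal) = 2 := by
          rw [← Nat.cast_one, Cardinal.succ_natCast]
          norm_num
        rwa [this])) (PseudoQuadraticSpace.f_self_ne_zero ho.star_ne) ho.f_eq_zero
      refine ho.f_self_ne_zero hc ?_
      rw [hc0, X.f_zero_left]
    · refine ho.false_of_ringEquiv hc ψ fun k hk => ?_
      rw [← hψ hIV heq ⟨k, hk⟩, PseudoQuadraticSpace.scalMap, dif_pos hk]
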